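/- Let $f,g\in\mathbb{C}\{x,y\}$ be holomorphic germs with $f(0,0)=g(0,0)=0$, and let $J=f_yg_x-f_xg_y$. An arc is a fractional power series $\xi(y)$ over $\mathbb{C}$ of positive order; $O_y$ denotes the order in $y$. A root of a germ $F$ is an arc $\gamma$ with $F(\gamma(y),y)=0$. Assume that all roots $\lambda$ of $f\cdot g$ are simple. A polar root is a root of $J$ that is not a root of $f\cdot g$; polar roots are counted with their multiplicities as roots of $J$. Tree. A bar $B$ (of finite height) has a height $h(B)\in\mathbb{Q}$ and a series $\lambda_B$. An arc $\xi$ climbs over $B$ at $a\in\mathbb{C}$ if $\xi=\lambda_B+ay^{h(B)}+(\text{higher order terms})$. The ground bar $B_*$ has $h(B_*)=0$, $\lambda_{B_*}=0$. If $B$ is a bar and $c\in\mathbb{C}$ is such that the set $T$ of roots of $f\cdot g$ climbing over $B$ at $c$ is non-empty, then $T$ is called a trunk growing on $B$ at $c$, with bimultiplicity $[p_c,q_c]$ if $T$ contains $p_c$ roots of $f$ and $q_c$ roots of $g$. If $T$ has at least two elements, the bar $B'$ with $h(B')=\min\{O_y(\lambda-\lambda'):\lambda,\lambda'\in T\}$,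 and with $\lambda_{B'}$ equal to any $\lambda\in T$ with all terms of exponent $\ge h(B')$ omitted, is called the postbar of $B$ supported at $c$. The bars are $B_*$ and all those obtained from it by repeatedly taking postbars. For $F\in\{f,g\}$ let $\nu_F(B)=O_y\big(F(\lambda_B(y)+zy^{h(B)},y)\big)$ for generic $z$; on $B_*$ this is the exponent of the largest power of $y$ dividing $F$. If a trunk grows on $B$ at $c$, put $\Delta_B(c)=\nu_f(B)\,q_c-\nu_g(B)\,p_c$. The point $c$ is collinear if $\Delta_B(c)=0$ and non-collinear otherwise; $C(B)$ and $N(B)$ are the sets of collinear and non-collinear points, and $n(B)=|N(B)|$. The bar $B$ is non-collinear if $N(B)\neq\emptyset$, and purely non-collinear if moreover $C(B)=\emptyset$. Let $\mathscr M_B(z)=\sum_{c\in C(B)\cup N(B)}\Delta_B(c)/(z-c)$, a rational function; $M(B)$ is the set of its zeros (mero-zeros), with $M(B)=\mathbb{C}$ if $\mathscr M_B\equiv0$. For a non-collinear bar $B$, $m(B)$ is the number of zeros counted with multiplicities. Repair. A partial repair of $B$ is a sequence of bars $\tilde B_0=B,\tilde B_1,\dots,\tilde B_t$ in which $\tilde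 B_{i+1}$ is the postbar of $\tilde B_i$ supported at some collinear point of $\tilde B_i$ for $0\le i<t$, and $\tilde B_t$ is purely non-collinear. The repair $\mathrm{rep}(B)$ is the set of all bars other than $B$ that appear in some partial repair of $B$ (it is empty if $C(B)=\emptyset$). A weed on $B$ is a polar root that climbs over $B$ at a point of $C(B)\cup M(B)$ and that, whenever it climbs over a bar $\hat B\in\mathrm{rep}(B)$, does so at a point of $C(\hat B)\cup M(\hat B)$. Let $w(B)$ be the number of weeds on $B$, counted with multiplicities. Theorem. Let $B$ be a non-collinear bar. Then $\mathrm{rep}(B)=\{\hat B_1,\dots,\hat B_r\}$ is finite, there are only finitely many weeds on $B$, and $$w(B)=m(B)+\sum_{s=1}^{r}n(\hat B_s).$$ -/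

import Mathlib

/-!
# The tree model of a pair of holomorphic germs in the plane

A germ is a convergent power series in `X 0 = x` and `X 1 = y`.  Fractional power series in `y` are
Hahn series over `ℚ` whose exponents have a common denominator.
-/

noncomputable section

namespace TreeModel

open HahnSeries

/-- Formal power series in `x = X 0` and `y = X 1`. -/
abbrev Series2 : Type := MvPowerSeries (Fin 2) ℂ

/-- Membership in the ring of convergent power series, i.e. being (the Taylor series of) a
holomorphic germ at the origin of the plane. -/
def IsConvergent (F : Series2) : Prop :=
  ∃ r : ℝ, 0 < r ∧
    Summable fun n : Fin 2 →₀ ℕ => ‖MvPowerSeries.coeff n F‖ * r ^ (n 0 + n 1)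

/-- The Jacobian determinant `J = f_y g_x - f_x g_y`. -/
def jacobian (f g : Series2) : Series2 :=
  MvPowerSeries.pderiv ℂ 1 f * MvPowerSeries.pderiv ℂ 0 g
    - MvPowerSeries.pderiv ℂ 0 f * MvPowerSeries.pderiv ℂ 1 g

/-- The series `γ` is a fractional power series of positive order: its exponents are positive
and have a common denominator. -/
def IsArc (γ : HahnSeries ℚ ℂ) : Prop :=
  0 < γ.orderTop ∧ ∃ D : ℕ, 0 < D ∧ ∀ e ∈ γ.support, ∃ k : ℕ, e = (k : ℚ) / D

/-- The series `y`. -/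
def yArc : HahnSeries ℚ ℂ := HahnSeries.single 1 1

/-- The series `F(γ(y), y)`, that is the sum over `(i, j)` of `a_{ij} γ(y)^i y^j`.
It is only used for `γ` of positive order. -/
def evalArc (F : Series2) (γ : HahnSeries ℚ ℂ) : HahnSeries ℚ ℂ :=
  (SummableFamily.smulFamily
    (fun ij : ℕ × ℕ => MvPowerSeries.coeff (Finsupp.single 0 ij.1 + Finsupp.single 1 ij.2) F)
    ((SummableFamily.powers γ).mul (SummableFamily.powers yArc))).hsum

/-- The Newton-Puiseux roots `x = γ(y)` of `F`, of positive order. -/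
def roots (F : Series2) : Set (HahnSeries ℚ ℂ) :=
  {γ | IsArc γ ∧ evalArc F γ = 0}

/-- The multiplicity of `γ` as a root of `F`: the least `n` such that the `n`-th derivative of `F`
with respect to `x` does not vanish along `γ`. -/
def rootMult (F : Series2) (γ : HahnSeries ℚ ℂ) : ℕ :=
  sInf {n : ℕ | evalArc ((MvPowerSeries.pderiv ℂ 0)^[n] F) γ ≠ 0}

/-- All Newton-Puiseux roots of `F` are simple. -/
def HasSimpleRoots (F : Series2) : Prop :=
  ∀ γ ∈ roots F, rootMult F γ = 1

/-- The polar roots of the pair: the roots of the Jacobian that are not roots of `f * g`. -/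
def polarRoots (f g : Series2) : Set (HahnSeries ℚ ℂ) :=
  {γ | γ ∈ roots (jacobian f g) ∧ γ ∉ roots (f * g)}

/-- The contact order `O(γ, γ')`, the order in `y` of `γ - γ'` (infinite if they are equal). -/
def contactOrder (γ γ' : HahnSeries ℚ ℂ) : WithTop ℚ := (γ - γ').orderTop

/-- A bar of finite height, given by the series `λ_B` (with no exponents `≥ h(B)`) and by its
height `h(B)`.  Which of these data are bars of the tree is said in `IsBar`. -/
@[ext]
structure Bar where
  center : HahnSeries ℚ ℂ
  height : ℚ

/-- The ground bar. -/
def groundBar : Bar := ⟨0, 0⟩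

/-- The arc `ξ` climbs over `B` at `a`, that is `ξ = λ_B + a y ^ h(B) + higher order terms`. -/
def ClimbsAt (ξ : HahnSeries ℚ ℂ) (B : Bar) (a : ℂ) : Prop :=
  (∀ e : ℚ, e < B.height → ξ.coeff e = B.center.coeff e) ∧ ξ.coeff B.height = a

/-- The roots of `F` which climb over `B` at `c`.  For `F = f * g` these sets, when non-empty, are
the trunks that grow on `B`. -/
def trunk (F : Series2) (B : Bar) (c : ℂ) : Set (HahnSeries ℚ ℂ) :=
  {γ | γ ∈ roots F ∧ ClimbsAt γ B c}

/-- The points of `B` at which a trunk grows. -/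
def trunkPoints (f g : Series2) (B : Bar) : Set ℂ :=
  {c | (trunk (f * g) B c).Nonempty}

/-- `B'` is the bar (of finite height) on top of the trunk that grows on `B` at `c`: its height is
the least contact order between roots in the trunk, and its series `λ_{B'}` is any of these roots
with all terms of exponent `≥ h(B')` omitted. -/
def IsPostbar (f g : Series2) (B : Bar) (c : ℂ) (B' : Bar) : Prop :=
  IsLeast {o : WithTop ℚ | ∃ γ ∈ trunk (f * g) B c, ∃ γ' ∈ trunk (f * g) B c,
      o = contactOrder γ γ'} (B'.height : WithTop ℚ) ∧
    ∃ γ ∈ trunk (f * g) B c, B'.center = HahnSeries.truncLT B'.height γ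

/-- The bars (of finite height) of the tree model of the pair. -/
inductive IsBar (f g : Series2) : Bar → Prop
  | ground : IsBar f g groundBar
  | post {B B' : Bar} {c : ℂ} : IsBar f g B → IsPostbar f g B c B' → IsBar f g B'

/-- `e` is the order in `y` of `F(λ_B(y) + z y ^ h(B), y)` for generic `z`. -/
def IsGenericOrder (F : Series2) (B : Bar) (e : ℚ) : Prop :=
  ∀ᶠ z : ℂ in Filter.cofinite,
    (evalArc F (B.center + HahnSeries.single B.height z)).orderTop = (e : WithTop ℚ)

theorem IsGenericOrder.unique {F : Series2} {B : Bar} {e e' : ℚ}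
    (h : IsGenericOrder F B e) (h' : IsGenericOrder F B e') : e = e' := by
  obtain ⟨z, hz, hz'⟩ := (h.and h').exists
  exact WithTop.coe_injective (hz.symm.trans hz')

open Classical in
/-- The order `ν_F(B)`.  On the ground bar, of height `0`, the order of `F(z, y)` for generic
small `z` is the exponent of the largest power of `y` that divides `F`. -/
def nu (F : Series2) (B : Bar) : ℚ :=
  if B.height = 0 then (multiplicity (MvPowerSeries.X 1 : Series2) F : ℚ)
  else Classical.epsilon fun e : ℚ => IsGenericOrder F B e

theorem nu_eq {F : Series2} {B : Bar} (hB : B.height ≠ 0) {e : ℚ} (h : IsGenericOrder F B e) :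
    nu F B = e := by
  rw [nu, if_neg hB]
  exact (Classical.epsilon_spec (p := fun e : ℚ => IsGenericOrder F B e) ⟨e, h⟩).unique h

/-- The determinant `ν_f(B) q - ν_g(B) p`, where `[p, q]` is the bimultiplicity of `c` on `B`. -/
def delta (f g : Series2) (B : Bar) (c : ℂ) : ℚ :=
  nu f B * ((trunk g B c).ncard : ℚ) - nu g B * ((trunk f B c).ncard : ℚ)

/-- The set `C(B)` of collinear points. -/
def collinearPoints (f g : Series2) (B : Bar) : Set ℂ :=
  {c | c ∈ trunkPoints f g B ∧ delta f g B c = 0}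

/-- The set `N(B)` of non-collinear points. -/
def nonCollinearPoints (f g : Series2) (B : Bar) : Set ℂ :=
  {c | c ∈ trunkPoints f g B ∧ delta f g B c ≠ 0}

/-- The number `n(B)` of non-collinear points. -/
def numNonCollinear (f g : Series2) (B : Bar) : ℕ :=
  (nonCollinearPoints f g B).ncard

/-- The bar `B` is non-collinear. -/
def IsNonCollinear (f g : Series2) (B : Bar) : Prop :=
  (nonCollinearPoints f g B).Nonempty

/-- The bar `B` is purely non-collinear. -/
def IsPurelyNonCollinear (f g : Series2) (B : Bar) : Prop :=
  collinearPoints f g B = ∅ ∧ (nonCollinearPoints f g B).Nonempty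

/-- The rational function associated to `B`, the sum of `Δ_B(z_k) / (z - z_k)` over the points
`z_k` at which trunks grow. -/
def meroFunction (f g : Series2) (B : Bar) : RatFunc ℂ :=
  ∑ᶠ c ∈ trunkPoints f g B,
    RatFunc.C ((delta f g B c : ℚ) : ℂ) / (RatFunc.X - RatFunc.C c)

/-- The set `M(B)` of zeros of the rational function of `B` (all of `ℂ` if it is zero).  The
numerator is that of the reduced fraction. -/
def meroZeros (f g : Series2) (B : Bar) : Set ℂ :=
  {z | (meroFunction f g B).num.eval z = 0}

/-- The multiplicity `m_B(z)` of a zero. -/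
def meroMult (f g : Series2) (B : Bar) (z : ℂ) : ℕ :=
  (meroFunction f g B).num.rootMultiplicity z

/-- The number `m(B)` of zeros, counted with multiplicities. -/
def numMeroZeros (f g : Series2) (B : Bar) : ℕ :=
  ∑ᶠ z ∈ meroZeros f g B, meroMult f g B z

/-- `l` is a partial repair of `B`: a sequence of bars that starts with `B` and ends with a purely
non-collinear bar, in which each bar after the first is a postbar of the preceding one supported at
a collinear point of it.  (If `B` has no collinear points, the only such sequence is that of `B`
alone, and the repair is empty.) -/
def IsPartialRepair (f g : Series2) (B : Bar) (l : List Bar) : Prop :=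
  l.head? = some B ∧
    List.IsChain (fun B₁ B₂ => ∃ c ∈ collinearPoints f g B₁, IsPostbar f g B₁ c B₂) l ∧
    ∃ B' : Bar, l.getLast? = some B' ∧ IsPurelyNonCollinear f g B'

/-- The repair of `B`: the bars, other than `B`, which appear in partial repairs of `B`. -/
def repair (f g : Series2) (B : Bar) : Set Bar :=
  {B' | B' ≠ B ∧ ∃ l : List Bar, IsPartialRepair f g B l ∧ B' ∈ l}

/-- The weeds on `B`. -/
def weeds (f g : Series2) (B : Bar) : Set (HahnSeries ℚ ℂ) :=
  {γ | γ ∈ polarRoots f g ∧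
    (∃ a ∈ collinearPoints f g B ∪ meroZeros f g B, ClimbsAt γ B a) ∧
    ∀ B' ∈ repair f g B, ∀ a : ℂ, ClimbsAt γ B' a →
      a ∈ collinearPoints f g B' ∪ meroZeros f g B'}

/-- The number `w(B)` of weeds on `B`, counted with their multiplicities as roots of the
Jacobian. -/
def numWeeds (f g : Series2) (B : Bar) : ℕ :=
  ∑ᶠ γ ∈ weeds f g B, rootMult (jacobian f g) γ

end TreeModel

end

/-! The proof counts roots of `J` bar by bar and compares them with roots of `f * g`. On a bar of
positive height, substitute `λ_B + z y^h`. The leading coefficients of `f` and `g` are polynomials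
`φ_f`, `φ_g` in `z`, whose zeros are the points where roots of `f` and `g` climb. Differentiation in
`x` lowers the order by `h` and differentiates the leading form. Hence `y J = (y d/dy f) g_x - f_x
(y d/dy g)`, read along the arc, has leading form `ν_f φ_f φ_g' - ν_g φ_f' φ_g`, and logarithmic
derivatives turn this into `φ_f φ_g M_B(z)`. On a non-collinear bar this polynomial is not zero, so
its zeros locate the roots of `J`: at a point `a` there are as many of them as there are roots of `f
* g` climbing at `a`, plus the multiplicity of `a` as a mero-zero, minus one if `a` is non-collinear
(`IsTreeRoots.count_jacobian`).

Let `R` be the number of roots of `f * g` in the collinear trunks of `B`. By the local count, `R +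
m(B)` roots of `J` climb over `B` at points of `C(B) ∪ M(B)`. Such a root fails to be a weed exactly
when it climbs over some bar of the repair at a non-collinear point. An arc does this on at most one
bar of the repair, and each of the `R` roots of `f * g` does it on exactly one, because the number
of roots over a bar drops strictly from a bar to its postbar. At each non-collinear point of a bar
of the repair there is one root of `J` fewer than there are roots of `f * g`, so the non-weeds
number `R - ∑ n(B̂)`. Subtraction gives the formula.

Three facts complete the argument: the Newton-Puiseux factorization of `f`, `g` and `J`, which makes
the counts meaningful; the simplicity of the roots of `f * g`, by which every root of `J` is polar;
and the ground bar, where both sides vanish. -/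

noncomputable section

namespace TreeModel

/-! ### Puiseux's theorem for monic polynomials over `ℂ⟦t⟧` -/

section Puiseux

open Polynomial

/-- Weierstrass preparation over `PowerSeries k` needs completeness in this form. -/
instance isAdicComplete_maximalIdeal_powerSeries (k : Type*) [Field k] :
    IsAdicComplete (IsLocalRing.maximalIdeal (PowerSeries k)) (PowerSeries k) := by
  rw [PowerSeries.maximalIdeal_eq_span_X]
  infer_instance

theorem constantCoeff_eq_zero_iff_residue {k : Type*} [Field k] (a : PowerSeries k) :
    IsLocalRing.residue _ a = 0 ↔ PowerSeries.constantCoeff a = 0 := by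
  rw [IsLocalRing.residue_eq_zero_iff, PowerSeries.maximalIdeal_eq_span_X,
    Ideal.mem_span_singleton, PowerSeries.X_dvd_iff]

/-- A monic polynomial over a power series ring splits off its roots near a given residue. -/
theorem exists_monic_factorization_taylor {k : Type*} [Field k] {Q : (PowerSeries k)[X]}
    (hQ : Q.Monic) (c : PowerSeries k) :
    ∃ f q : (PowerSeries k)[X], f.Monic ∧ q.Monic ∧ taylor c Q = f * q ∧
      (∀ i < f.natDegree, PowerSeries.constantCoeff ((taylor c Q).coeff i) = 0) ∧
      PowerSeries.constantCoeff ((taylor c Q).coeff f.natDegree) ≠ 0 := by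
  set T := taylor c Q with hT
  have hTm : T.Monic := by
    rw [Polynomial.Monic, hT, leadingCoeff_taylor]; exact hQ
  have hres : (T : PowerSeries (PowerSeries k)).map (IsLocalRing.residue _) ≠ 0 := by
    intro h
    have := congrArg (PowerSeries.coeff T.natDegree) h
    simp [hTm.coeff_natDegree] at this
  obtain ⟨f, h, H⟩ := PowerSeries.exists_isWeierstrassFactorization hres
  have hfm : f.Monic := H.isDistinguishedAt.monic
  have hdeg := H.natDegree_eq_toNat_order_map
  -- The Weierstrass cofactor `h` is only known to be a power series. Uniqueness of Weierstrass
  -- division identifies it with the polynomial quotient and makes the remainder vanish.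
  have hdvd : T %ₘ f = 0 := by
    have hd := H.isDistinguishedAt.isWeierstrassDivisorAt'
    have hd' := H.isDistinguishedAt.isWeierstrassDivisorAt'
    have e1 : (f : PowerSeries (PowerSeries k)) * (T /ₘ f : (PowerSeries k)[X]) +
        (T %ₘ f : (PowerSeries k)[X]) = f * h + ((0 : (PowerSeries k)[X])) := by
      rw [Polynomial.coe_zero, add_zero, ← H.eq_mul, ← Polynomial.coe_mul, ← Polynomial.coe_add,
        add_comm, modByMonic_add_div]
    have horder : f.natDegree = ((f : PowerSeries (PowerSeries k)).map
        (Ideal.Quotient.mk (IsLocalRing.maximalIdeal (PowerSeries k)))).order.toNat := by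
      have := H.isDistinguishedAt.coe_natDegree_eq_order_map f 1 (by
        simp) (by simp)
      rw [← this]; simp
    refine (hd.eq_of_mul_add_eq_mul_add ?_ ?_ e1).2
    · rw [← horder, ← degree_eq_natDegree hfm.ne_zero]
      exact degree_modByMonic_lt _ hfm
    · simp [bot_lt_iff_ne_bot]
  have hmul : T = f * (T /ₘ f) := by
    conv_lhs => rw [← modByMonic_add_div T f, hdvd, zero_add]
  refine ⟨f, T /ₘ f, hfm, ?_, hmul, ?_, ?_⟩
  · rw [hmul] at hTm
    exact hfm.of_mul_monic_left hTm
  · intro i hi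
    rw [← constantCoeff_eq_zero_iff_residue, ← Polynomial.coeff_coe, ← PowerSeries.coeff_map]
    apply PowerSeries.coeff_of_lt_order_toNat
    rwa [← hdeg]
  · rw [Ne, ← constantCoeff_eq_zero_iff_residue, ← Polynomial.coeff_coe, ← PowerSeries.coeff_map,
      hdeg]
    exact PowerSeries.coeff_order hres

/-- The substitution of `t ^ D` for the variable `t` of a power series. -/
def expandHom (D : ℕ) (hD : D ≠ 0) : PowerSeries ℂ →+* PowerSeries ℂ :=
  (PowerSeries.expand (R := ℂ) D hD : PowerSeries ℂ →ₐ[ℂ] PowerSeries ℂ)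

theorem expandHom_apply (D : ℕ) (hD : D ≠ 0) (a : PowerSeries ℂ) :
    expandHom D hD a = PowerSeries.expand D hD a := rfl

/-- The polynomial splits over the power series in some root of the variable. -/
def SplitsAfterExpand (P : (PowerSeries ℂ)[X]) : Prop :=
  ∃ D : ℕ, ∃ hD : D ≠ 0, (P.map (expandHom D hD)).Splits

theorem map_expand_map_expand (P : (PowerSeries ℂ)[X]) {D E : ℕ} (hD : D ≠ 0) (hE : E ≠ 0) :
    (P.map (expandHom E hE)).map
      (expandHom D hD) =
    P.map (expandHom (D * E) (mul_ne_zero hD hE)) := by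
  rw [Polynomial.map_map]
  congr 1
  ext1 a
  exact (PowerSeries.expand_mul D hD E hE a).symm

theorem SplitsAfterExpand.mul {P Q : (PowerSeries ℂ)[X]} (hP : SplitsAfterExpand P)
    (hQ : SplitsAfterExpand Q) : SplitsAfterExpand (P * Q) := by
  obtain ⟨D, hD, h⟩ := hP
  obtain ⟨E, hE, h'⟩ := hQ
  refine ⟨D * E, mul_ne_zero hD hE, ?_⟩
  rw [Polynomial.map_mul]
  refine .mul ?_ ?_
  · have := h.map (expandHom E hE)
    rw [map_expand_map_expand] at this
    simpa only [mul_comm] using this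
  · have := h'.map (expandHom D hD)
    rwa [map_expand_map_expand] at this

theorem SplitsAfterExpand.of_taylor {P : (PowerSeries ℂ)[X]} {b : PowerSeries ℂ}
    (h : SplitsAfterExpand (taylor b P)) : SplitsAfterExpand P := by
  obtain ⟨D, hD, h⟩ := h
  refine ⟨D, hD, ?_⟩
  rw [map_taylor] at h
  have := h.taylor (-(expandHom D hD) b)
  rwa [taylor_taylor, neg_add_cancel, taylor_zero] at this

theorem SplitsAfterExpand.of_expand {P : (PowerSeries ℂ)[X]} {E : ℕ} (hE : E ≠ 0)
    (h : SplitsAfterExpand (P.map (expandHom E hE))) :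
    SplitsAfterExpand P := by
  obtain ⟨D, hD, h⟩ := h
  rw [map_expand_map_expand] at h
  exact ⟨_, _, h⟩

theorem SplitsAfterExpand.scaleRoots {P : (PowerSeries ℂ)[X]} (hP : P.Monic)
    (h : SplitsAfterExpand P) (s : PowerSeries ℂ) : SplitsAfterExpand (P.scaleRoots s) := by
  obtain ⟨D, hD, h⟩ := h
  refine ⟨D, hD, ?_⟩
  rw [map_scaleRoots _ _ _ (by simp [hP.leadingCoeff])]
  exact h.scaleRoots _

/-- The Tschirnhaus shift by `-a_n / (n + 1)`. A vanishing subleading coefficient later prevents a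
reduction from having a single nonzero root. -/
theorem exists_taylor_coeff_eq_zero {P : (PowerSeries ℂ)[X]} (hP : P.Monic) {n : ℕ}
    (hn : P.natDegree = n + 1) : ∃ b : PowerSeries ℂ, (taylor b P).coeff n = 0 := by
  refine ⟨PowerSeries.C (-((n : ℂ) + 1)⁻¹) * P.coeff n, ?_⟩
  have hlt : (hasseDeriv n P).natDegree < 2 := by
    have := natDegree_hasseDeriv_le P n
    omega
  have h1 : P.coeff (1 + n) = 1 := by
    rw [add_comm, ← hn]; exact hP.coeff_natDegree
  have hne : (n : ℂ) + 1 ≠ 0 := by exact_mod_cast n.succ_ne_zero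
  have hC : (PowerSeries.C (-((n : ℂ) + 1)⁻¹)) * ((n : PowerSeries ℂ) + 1) = -1 := by
    have : ((n : PowerSeries ℂ) + 1) = PowerSeries.C ((n : ℂ) + 1) := by simp
    rw [this, ← map_mul, neg_mul, inv_mul_cancel₀ hne]; simp
  rw [taylor_coeff, eval_eq_sum_range' hlt, Finset.sum_range_succ, Finset.sum_range_one]
  simp only [hasseDeriv_coeff, h1, zero_add, Nat.choose_self, Nat.cast_one, one_mul, pow_zero,
    mul_one, pow_one]
  rw [add_comm 1 n, Nat.choose_succ_self_right]
  push_cast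
  linear_combination P.coeff n * hC

/-- The step of the Newton polygon: after a change of variables, a monic polynomial without
subleading term whose lower coefficients do not all vanish has a non-trivial reduction. -/
theorem exists_map_expand_eq_scaleRoots {P : (PowerSeries ℂ)[X]} (hP : P.Monic) {n : ℕ}
    (hn : P.natDegree = n) (hex : ∃ i < n, P.coeff i ≠ 0) :
    ∃ (E : ℕ) (hE : E ≠ 0) (p : ℕ) (Q : (PowerSeries ℂ)[X]), Q.Monic ∧ Q.natDegree = n ∧
      P.map (expandHom E hE) = Q.scaleRoots (PowerSeries.X ^ p) ∧
      ∃ i < n, PowerSeries.constantCoeff (Q.coeff i) ≠ 0 := by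
  classical
  set I := (Finset.range n).filter fun i => P.coeff i ≠ 0 with hI
  have hIne : I.Nonempty := by
    obtain ⟨i, hi, h⟩ := hex
    exact ⟨i, by simp [hI, hi, h]⟩
  -- The minimum of `ord(a_i) / (n - i)` is the slope of the Newton polygon that gives the least
  -- order of a root. Replacing `t` by `t ^ (n - i₀)` turns this slope into the integer `p`, so that
  -- `t ^ p` can be divided out of all roots.
  obtain ⟨i₀, hi₀, hmin⟩ := Finset.exists_min_image I
    (fun i => ((P.coeff i).order.toNat : ℚ) / ((n - i : ℕ) : ℚ)) hIne
  have hi₀n : i₀ < n := by simp [hI] at hi₀; exact hi₀.1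
  have hi₀c : P.coeff i₀ ≠ 0 := by simp [hI] at hi₀; exact hi₀.2
  set p := (P.coeff i₀).order.toNat with hp
  have hE : n - i₀ ≠ 0 := by omega
  have hdvd : ∀ i ∈ Finset.range n, ∃ b : PowerSeries ℂ,
      expandHom (n - i₀) hE (P.coeff i) = b * (PowerSeries.X ^ p) ^ (n - i) := by
    intro i hi
    rw [Finset.mem_range] at hi
    by_cases h0 : P.coeff i = 0
    · exact ⟨0, by simp [h0]⟩
    obtain ⟨u, hu⟩ := PowerSeries.X_pow_order_dvd (φ := P.coeff i)
    have hle := hmin i (by simp [hI, hi, h0])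
    have h1 : (0 : ℚ) < ((n - i : ℕ) : ℚ) := by exact_mod_cast Nat.sub_pos_of_lt hi
    have h2 : (0 : ℚ) < ((n - i₀ : ℕ) : ℚ) := by exact_mod_cast Nat.sub_pos_of_lt hi₀n
    rw [div_le_div_iff₀ h2 h1] at hle
    have hle' : p * (n - i) ≤ (n - i₀) * (P.coeff i).order.toNat := by
      rw [mul_comm (n - i₀)]
      exact_mod_cast hle
    have : (PowerSeries.X ^ p) ^ (n - i) ∣ expandHom (n - i₀) hE (P.coeff i) := by
      rw [hu, map_mul, map_pow, expandHom_apply, PowerSeries.expand_X, ← pow_mul, ← pow_mul]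
      exact (pow_dvd_pow _ hle').mul_right _
    obtain ⟨b, hb⟩ := this
    exact ⟨b, by rw [hb, mul_comm]⟩
  choose! b hb using hdvd
  set Q : (PowerSeries ℂ)[X] := X ^ n + ∑ i ∈ Finset.range n, C (b i) * X ^ i with hQ
  have hdeg : (∑ i ∈ Finset.range n, C (b i) * X ^ i).degree < (n : WithBot ℕ) := by
    rw [degree_lt_iff_coeff_zero]
    intro m hm
    rw [finsetSum_coeff]
    refine Finset.sum_eq_zero fun i hi => ?_
    rw [coeff_C_mul_X_pow, if_neg]
    rw [Finset.mem_range] at hi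
    omega
  have hQm : Q.Monic := monic_X_pow_add hdeg
  have hQn : Q.natDegree = n := by
    have : Q.degree = n := by
      rw [hQ, degree_add_eq_left_of_degree_lt (by simpa using hdeg), degree_X_pow]
    exact natDegree_eq_of_degree_eq_some this
  have hQc : ∀ i < n, Q.coeff i = b i := by
    intro i hi
    rw [hQ, coeff_add, coeff_X_pow, if_neg hi.ne, zero_add, finsetSum_coeff]
    simp [hi]
  refine ⟨n - i₀, hE, p, Q, hQm, hQn, ?_, i₀, hi₀n, ?_⟩
  · ext1 i
    rw [coeff_scaleRoots, hQn, coeff_map]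
    rcases lt_trichotomy i n with h | h | h
    · rw [hQc i h, hb i (by simpa using h)]
    · subst h
      have h1 : P.coeff i = 1 := by rw [← hn]; exact hP.coeff_natDegree
      have h2 : Q.coeff i = 1 := by
        have := hQm.coeff_natDegree
        rwa [hQn] at this
      simp [h1, h2]
    · rw [coeff_eq_zero_of_natDegree_lt (by omega), coeff_eq_zero_of_natDegree_lt (by omega)]
      simp
  · rw [hQc i₀ hi₀n]
    intro h
    have h1 := congrArg (PowerSeries.coeff ((n - i₀) * p)) (hb i₀ (by simpa using hi₀n))
    rw [expandHom_apply, PowerSeries.coeff_expand_mul, ← pow_mul, mul_comm p,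
      PowerSeries.coeff_mul_X_pow', if_pos le_rfl, Nat.sub_self,
      PowerSeries.coeff_zero_eq_constantCoeff_apply, h] at h1
    exact PowerSeries.coeff_order hi₀c h1

/-- **Puiseux's theorem**: a monic polynomial over the power series splits after passing to a root
of the variable. -/
theorem splitsAfterExpand_of_monic (P : (PowerSeries ℂ)[X]) (hP : P.Monic) :
    SplitsAfterExpand P := by
  induction hn : P.natDegree using Nat.strong_induction_on generalizing P with
  | _ n ih =>
  rcases Nat.lt_or_ge n 2 with hlt | hge
  · exact ⟨1, one_ne_zero, .of_natDegree_le_one_of_monic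
      ((natDegree_map_le).trans (by omega)) (hP.map _)⟩
  obtain ⟨m, rfl⟩ : ∃ m, n = m + 1 := ⟨n - 1, by omega⟩
  obtain ⟨b, hb⟩ := exists_taylor_coeff_eq_zero hP hn
  apply SplitsAfterExpand.of_taylor (b := b)
  have hP' : (taylor b P).Monic := by rw [Polynomial.Monic, leadingCoeff_taylor]; exact hP
  have hn' : (taylor b P).natDegree = m + 1 := by rw [natDegree_taylor, hn]
  generalize taylor b P = P at *
  by_cases hex : ∃ i < m + 1, P.coeff i ≠ 0
  swap
  · push Not at hex
    have : P = X ^ (m + 1) := by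
      ext1 i
      rw [coeff_X_pow]
      split_ifs with h
      · rw [h, ← hn']; exact hP'.coeff_natDegree
      · rcases lt_or_gt_of_ne h with h | h
        · exact hex i h
        · exact coeff_eq_zero_of_natDegree_lt (by omega)
    rw [this]
    exact ⟨1, one_ne_zero, by rw [Polynomial.map_pow, map_X]; exact .X_pow _⟩
  obtain ⟨E, hE, p, Q, hQ, hQn, hPQ, i₀, hi₀, hc₀⟩ := exists_map_expand_eq_scaleRoots hP' hn' hex
  apply SplitsAfterExpand.of_expand hE
  rw [hPQ]
  refine SplitsAfterExpand.scaleRoots hQ ?_ _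
  have hQm : PowerSeries.constantCoeff (Q.coeff m) = 0 := by
    have := congrArg (fun R : (PowerSeries ℂ)[X] => R.coeff m) hPQ
    simp only [coeff_map, hb, map_zero, coeff_scaleRoots] at this
    have h0 := (mul_eq_zero.mp this.symm).resolve_right (by simp)
    rw [h0, map_zero]
  set Q₀ : ℂ[X] := Q.map (PowerSeries.constantCoeff (R := ℂ)) with hQ₀
  have hQ₀n : Q₀.natDegree = m + 1 := by rw [hQ₀, hQ.natDegree_map, hQn]
  obtain ⟨c, hc⟩ := IsAlgClosed.exists_root Q₀ (by
    rw [degree_eq_natDegree (hQ.map _).ne_zero, hQ₀n]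
    exact_mod_cast m.succ_ne_zero)
  -- The factor `f` collects the roots with residue `c`. Once both factors have positive degree, the
  -- induction applies to each of them.
  obtain ⟨f, q, hf, hq, hfq, hlow, htop⟩ :=
    exists_monic_factorization_taylor hQ (PowerSeries.C c)
  have hT : ∀ i, PowerSeries.constantCoeff ((taylor (PowerSeries.C c) Q).coeff i) =
      (taylor c Q₀).coeff i := by
    intro i
    rw [hQ₀, ← Polynomial.coeff_map, map_taylor]; simp
  have hdeg : f.natDegree + q.natDegree = m + 1 := by
    rw [← hf.natDegree_mul hq, ← hfq, natDegree_taylor, hQn]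
  have hfpos : f.natDegree ≠ 0 := by
    intro h
    rw [h, hT, taylor_coeff_zero] at htop
    exact htop hc
  -- Otherwise the reduction is `(x - c) ^ (m + 1)`. Its subleading coefficient vanishes, so `c =
  -- 0`, and the nonzero coefficient at `i₀ < m + 1` is a contradiction.
  have hqpos : q.natDegree ≠ 0 := by
    intro h
    have hfn : f.natDegree = m + 1 := by omega
    have hX : taylor c Q₀ = X ^ (m + 1) := by
      ext1 i
      rw [coeff_X_pow]
      split_ifs with h'
      · have : (taylor c Q₀).Monic := by
          rw [Polynomial.Monic, leadingCoeff_taylor]; exact hQ.map _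
        have := this.coeff_natDegree
        rwa [natDegree_taylor, hQ₀n, ← h'] at this
      · rcases lt_or_gt_of_ne h' with h' | h'
        · rw [← hT]; exact hlow i (by omega)
        · exact coeff_eq_zero_of_natDegree_lt (by rw [natDegree_taylor]; omega)
    have hQX : Q₀ = (X + C (-c)) ^ (m + 1) := by
      have := congrArg (taylor (-c)) hX
      rwa [taylor_taylor, neg_add_cancel, taylor_zero, taylor_X_pow] at this
    have hm : Q₀.coeff m = 0 := by rw [hQ₀, coeff_map]; exact hQm
    rw [hQX, coeff_X_add_C_pow, Nat.choose_succ_self_right] at hm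
    have hc0 : c = 0 := by
      have hne : ((m + 1 : ℕ) : ℂ) ≠ 0 := by exact_mod_cast m.succ_ne_zero
      have := (mul_eq_zero.mp hm).resolve_right hne
      simpa using this
    have : Q₀.coeff i₀ = 0 := by
      rw [hQX, hc0]; simp [coeff_X_pow, hi₀.ne]
    exact hc₀ (by rwa [hQ₀, coeff_map] at this)
  apply SplitsAfterExpand.of_taylor (b := PowerSeries.C c)
  rw [hfq]
  exact (ih _ (by omega) f hf rfl).mul (ih _ (by omega) q hq rfl)

end Puiseux

end TreeModel

end

noncomputable section

namespace TreeModel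

/-! ### Orders of generalized power series -/

section HahnOrder

theorem coe_add_le_orderTop_mul {x y : HahnSeries ℚ ℂ} {a b : ℚ}
    (hx : (a : WithTop ℚ) ≤ x.orderTop) (hy : (b : WithTop ℚ) ≤ y.orderTop) :
    ((a + b : ℚ) : WithTop ℚ) ≤ (x * y).orderTop := by
  rw [WithTop.coe_add]
  exact (add_le_add hx hy).trans HahnSeries.orderTop_add_le_mul

theorem coe_nsmul_le_orderTop_pow {x : HahnSeries ℚ ℂ} {a : ℚ}
    (hx : (a : WithTop ℚ) ≤ x.orderTop) (n : ℕ) :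
    ((a * n : ℚ) : WithTop ℚ) ≤ (x ^ n).orderTop := by
  induction n with
  | zero => simp
  | succ n ih =>
    rw [pow_succ]
    have := coe_add_le_orderTop_mul ih hx
    rwa [show a * ((n + 1 : ℕ) : ℚ) = a * n + a by push_cast; ring]

theorem coe_le_orderTop_sub {x y : HahnSeries ℚ ℂ} {a : WithTop ℚ}
    (hx : a ≤ x.orderTop) (hy : a ≤ y.orderTop) : a ≤ (x - y).orderTop :=
  (le_min hx hy).trans HahnSeries.min_orderTop_le_orderTop_sub

/-- The bound `δ ≤ 1` makes `δ` a lower bound for the order of `y` as well, so one constant serves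
both variables. -/
theorem exists_pos_le_orderTop {γ : HahnSeries ℚ ℂ} (hγ : 0 < γ.orderTop) :
    ∃ δ : ℚ, 0 < δ ∧ δ ≤ 1 ∧ (δ : WithTop ℚ) ≤ γ.orderTop := by
  induction h : γ.orderTop using WithTop.recTopCoe with
  | top => exact ⟨1, one_pos, le_rfl, le_top⟩
  | coe a =>
    rw [h] at hγ
    have ha : 0 < a := by exact_mod_cast hγ
    exact ⟨min a 1, lt_min ha one_pos, min_le_right _ _, by exact_mod_cast min_le_left _ _⟩

theorem orderTop_yArc : yArc.orderTop = 1 := by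
  rw [yArc, HahnSeries.orderTop_single one_ne_zero]; rfl

theorem orderTop_yArc_pos : 0 < yArc.orderTop := by
  rw [orderTop_yArc]; exact one_pos

end HahnOrder

/-! ### Substitution of an arc as a ring homomorphism -/

section Evaluation

variable {γ : HahnSeries ℚ ℂ}

theorem coeff_evalArc (F : Series2) (hγ : 0 < γ.orderTop) (e : ℚ) :
    (evalArc F γ).coeff e = ∑ᶠ ij : ℕ × ℕ,
      MvPowerSeries.coeff (Finsupp.single 0 ij.1 + Finsupp.single 1 ij.2) F *
        (γ ^ ij.1 * yArc ^ ij.2).coeff e := by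
  simp [evalArc, HahnSeries.SummableFamily.coeff_hsum, hγ, orderTop_yArc_pos]

theorem evalArc_add (F G : Series2) (γ : HahnSeries ℚ ℂ) :
    evalArc (F + G) γ = evalArc F γ + evalArc G γ := by
  rw [evalArc, evalArc, evalArc, ← HahnSeries.SummableFamily.hsum_add]
  congr 1
  ext a : 1
  exact add_smul _ _ _

theorem evalArc_zero (γ : HahnSeries ℚ ℂ) : evalArc 0 γ = 0 := by
  simpa using evalArc_add 0 0 γ

theorem evalArc_monomial (hγ : 0 < γ.orderTop) (n : Fin 2 →₀ ℕ) (a : ℂ) :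
    evalArc (MvPowerSeries.monomial n a) γ =
      HahnSeries.C a * (γ ^ n 0 * yArc ^ n 1) := by
  ext e
  rw [HahnSeries.C_mul_eq_smul, coeff_evalArc _ hγ, finsum_eq_single _ (n 0, n 1)]
  · have : Finsupp.single 0 (n 0) + Finsupp.single 1 (n 1) = n := by
      ext i; fin_cases i <;> simp
    simp [this]
  · rintro ⟨i, j⟩ hij
    rw [MvPowerSeries.coeff_monomial, if_neg, zero_mul]
    rintro rfl
    simp at hij

theorem evalArc_coe (hγ : 0 < γ.orderTop) (p : MvPolynomial (Fin 2) ℂ) :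
    evalArc (p : Series2) γ = MvPolynomial.eval₂ HahnSeries.C ![γ, yArc] p := by
  induction p using MvPolynomial.induction_on' with
  | monomial u a =>
    rw [MvPolynomial.coe_monomial, evalArc_monomial hγ, MvPolynomial.eval₂_monomial,
      Finsupp.prod_fintype _ _ (by simp), Fin.prod_univ_two]
    simp
  | add p q hp hq => rw [MvPolynomial.coe_add, evalArc_add, hp, hq, MvPolynomial.eval₂_add]

/-- Along the arc, `x ^ i y ^ j` has order at least `δ (i + j)`. This is the continuity of
evaluation for the total degree, and it allows identities to be checked on polynomials. -/
theorem le_orderTop_evalArc {δ : ℚ} (hδ : 0 ≤ δ) (hδ1 : δ ≤ 1) (hγ : 0 < γ.orderTop)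
    (hδγ : (δ : WithTop ℚ) ≤ γ.orderTop) {N : ℕ} {F : Series2} (hF : (N : ℕ∞) ≤ F.order) :
    ((δ * N : ℚ) : WithTop ℚ) ≤ (evalArc F γ).orderTop := by
  rw [HahnSeries.le_orderTop_iff_forall]
  intro e he
  rw [coeff_evalArc _ hγ]
  refine finsum_eq_zero_of_forall_eq_zero fun ij => ?_
  rcases lt_or_ge (ij.1 + ij.2) N with h | h
  · rw [MvPowerSeries.coeff_of_lt_order, zero_mul]
    refine lt_of_lt_of_le ?_ hF
    rw [map_add, Finsupp.degree_single, Finsupp.degree_single]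
    exact_mod_cast h
  · rw [HahnSeries.coeff_eq_zero_of_lt_orderTop, mul_zero]
    refine he.trans_le ?_
    have h1 : ((1 : ℚ) : WithTop ℚ) ≤ yArc.orderTop := orderTop_yArc.ge
    refine le_trans ?_ (coe_add_le_orderTop_mul (coe_nsmul_le_orderTop_pow hδγ ij.1)
      (coe_nsmul_le_orderTop_pow h1 ij.2))
    have h' : (N : ℚ) ≤ ij.1 + ij.2 := by exact_mod_cast h
    have h2 : (0 : ℚ) ≤ ij.2 := by positivity
    have : δ * N ≤ δ * ij.1 + 1 * ij.2 := by nlinarith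
    exact_mod_cast this

theorem zero_le_orderTop_evalArc (hγ : 0 < γ.orderTop) (F : Series2) :
    0 ≤ (evalArc F γ).orderTop := by
  have := le_orderTop_evalArc (N := 0) (F := F) le_rfl zero_le_one hγ (by simpa using hγ.le)
    (by simp)
  simpa using this

/-- An additive map on power series is zero if it vanishes on polynomials and is continuous. -/
theorem eq_zero_of_forall_coe (Ψ : Series2 →+ HahnSeries ℚ ℂ)
    (hpoly : ∀ p : MvPolynomial (Fin 2) ℂ, Ψ p = 0) {δ : ℚ} (hδ : 0 < δ)
    (hcont : ∀ (N : ℕ) (F : Series2), ((N + 1 : ℕ) : ℕ∞) ≤ F.order →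
      ((δ * N : ℚ) : WithTop ℚ) ≤ (Ψ F).orderTop) (F : Series2) : Ψ F = 0 := by
  ext e
  rw [HahnSeries.coeff_zero]
  -- Truncating beyond degree `N` pushes the image past the exponent `e`. In `hcont`, the degree `N
  -- + 1` is set against the bound `δ * N` to leave room for derivatives, which lower the degree by
  -- one.
  obtain ⟨N, hN⟩ := exists_nat_gt (e / δ)
  have h1 : Ψ F = Ψ (F - (MvPowerSeries.truncTotal (N + 1) F : MvPolynomial (Fin 2) ℂ)) := by
    rw [map_sub, hpoly, sub_zero]
  rw [h1]
  apply HahnSeries.coeff_eq_zero_of_lt_orderTop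
  refine lt_of_lt_of_le ?_ (hcont N _ ?_)
  · rw [div_lt_iff₀ hδ, mul_comm] at hN
    exact_mod_cast hN
  · apply MvPowerSeries.nat_le_order
    intro d hd
    rw [map_sub, MvPolynomial.coeff_coe, MvPowerSeries.coeff_truncTotal _ hd, sub_self]

/-- Density of polynomials is used twice, once in each factor; for two polynomials the identity is
multiplicativity of `MvPolynomial.eval₂`. -/
theorem evalArc_mul (hγ : 0 < γ.orderTop) (F G : Series2) :
    evalArc (F * G) γ = evalArc F γ * evalArc G γ := by
  obtain ⟨δ, hδ, hδ1, hδγ⟩ := exists_pos_le_orderTop hγ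
  have hle : ∀ (N : ℕ) (F : Series2), ((N + 1 : ℕ) : ℕ∞) ≤ F.order →
      ((δ * N : ℚ) : WithTop ℚ) ≤ (evalArc F γ).orderTop := fun N F hF =>
    le_orderTop_evalArc hδ.le hδ1 hγ hδγ (le_trans (by exact_mod_cast N.le_succ) hF)
  have key : ∀ G : Series2, (∀ p : MvPolynomial (Fin 2) ℂ,
      evalArc (p * G) γ = evalArc p γ * evalArc G γ) → ∀ F : Series2,
      evalArc (F * G) γ = evalArc F γ * evalArc G γ := by
    intro G hG F
    let Ψ : Series2 →+ HahnSeries ℚ ℂ := AddMonoidHom.mk'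
      (fun F => evalArc (F * G) γ - evalArc F γ * evalArc G γ) (by
        intro a b
        rw [add_mul, evalArc_add, evalArc_add]; ring)
    refine sub_eq_zero.mp (eq_zero_of_forall_coe Ψ (fun p => sub_eq_zero.mpr (hG p)) hδ ?_ F)
    intro N F hF
    refine coe_le_orderTop_sub (hle N _ (hF.trans ?_)) ?_
    · exact le_trans (le_add_of_nonneg_right bot_le) MvPowerSeries.le_order_mul
    · have := coe_add_le_orderTop_mul (hle N F hF)
        (b := 0) (y := evalArc G γ) (by simpa using zero_le_orderTop_evalArc hγ G)
      simpa using this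
  refine key G (fun p => ?_) F
  rw [mul_comm, mul_comm (evalArc _ γ)]
  refine key p (fun q => ?_) G
  rw [← MvPolynomial.coe_mul, evalArc_coe hγ, evalArc_coe hγ, evalArc_coe hγ, MvPolynomial.eval₂_mul]

/-- Substitution of an arc is a ring homomorphism. -/
def evalHom (γ : HahnSeries ℚ ℂ) (hγ : 0 < γ.orderTop) : Series2 →+* HahnSeries ℚ ℂ where
  toFun F := evalArc F γ
  map_one' := by
    rw [← MvPolynomial.coe_one, evalArc_coe hγ, MvPolynomial.eval₂_one]
  map_mul' := evalArc_mul hγ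
  map_zero' := evalArc_zero γ
  map_add' F G := evalArc_add F G γ

theorem evalHom_apply (hγ : 0 < γ.orderTop) (F : Series2) : evalHom γ hγ F = evalArc F γ := rfl

theorem evalArc_X_zero (hγ : 0 < γ.orderTop) : evalArc (MvPowerSeries.X 0) γ = γ := by
  rw [← MvPolynomial.coe_X, evalArc_coe hγ, MvPolynomial.eval₂_X]; rfl

theorem evalArc_X_one (hγ : 0 < γ.orderTop) : evalArc (MvPowerSeries.X 1) γ = yArc := by
  rw [← MvPolynomial.coe_X, evalArc_coe hγ, MvPolynomial.eval₂_X]; rfl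

theorem lt_orderTop_evalArc (hγ : 0 < γ.orderTop) {F : Series2}
    (hF : MvPowerSeries.constantCoeff F = 0) : 0 < (evalArc F γ).orderTop := by
  obtain ⟨δ, hδ, hδ1, hδγ⟩ := exists_pos_le_orderTop hγ
  have := le_orderTop_evalArc (N := 1) (F := F) hδ.le hδ1 hγ hδγ
    (by simpa using (MvPowerSeries.one_le_order_iff_constCoeff_eq_zero).mpr hF)
  refine lt_of_lt_of_le ?_ this
  simpa using hδ

end Evaluation

/-! ### The Euler operator and the chain rule along an arc -/

section EulerDerivation

/-- The Euler operator `y d/dy` on generalized power series. -/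
def euler (x : HahnSeries ℚ ℂ) : HahnSeries ℚ ℂ where
  coeff e := (e : ℂ) * x.coeff e
  isPWO_support' := x.isPWO_support.mono fun e he => by
    rw [Function.mem_support] at he
    exact right_ne_zero_of_mul he

@[simp]
theorem coeff_euler (x : HahnSeries ℚ ℂ) (e : ℚ) : (euler x).coeff e = (e : ℂ) * x.coeff e := rfl

theorem euler_add (x y : HahnSeries ℚ ℂ) : euler (x + y) = euler x + euler y := by
  ext e; simp [mul_add]

theorem support_euler_subset (x : HahnSeries ℚ ℂ) : (euler x).support ⊆ x.support := by
  intro e he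
  rw [HahnSeries.mem_support] at he ⊢
  exact right_ne_zero_of_mul he

theorem euler_mul (x y : HahnSeries ℚ ℂ) : euler (x * y) = euler x * y + x * euler y := by
  ext e
  rw [HahnSeries.coeff_add, HahnSeries.coeff_mul_left' x.isPWO_support (support_euler_subset x),
    HahnSeries.coeff_mul_right' y.isPWO_support (support_euler_subset y), coeff_euler,
    HahnSeries.coeff_mul, Finset.mul_sum, ← Finset.sum_add_distrib]
  refine Finset.sum_congr rfl fun ij hij => ?_
  have h : ij.1 + ij.2 = e := (Finset.mem_antidiagonal.mp hij).2.2
  rw [coeff_euler, coeff_euler, ← h]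
  push_cast
  ring

theorem orderTop_le_orderTop_euler (x : HahnSeries ℚ ℂ) : x.orderTop ≤ (euler x).orderTop := by
  rw [HahnSeries.le_orderTop_iff_forall]
  intro e he
  rw [coeff_euler, HahnSeries.coeff_eq_zero_of_lt_orderTop he, mul_zero]

theorem euler_ne_zero {x : HahnSeries ℚ ℂ} (hx : x ≠ 0) (hpos : 0 < x.orderTop) :
    euler x ≠ 0 := by
  intro h
  obtain ⟨e, he⟩ := WithTop.ne_top_iff_exists.mp (HahnSeries.orderTop_ne_top.mpr hx)
  have h1 := congrArg (fun z => HahnSeries.coeff z e) h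
  rw [← he] at hpos
  have he0 : 0 < e := by exact_mod_cast hpos
  simp only [coeff_euler, HahnSeries.coeff_zero, mul_eq_zero] at h1
  rcases h1 with h1 | h1
  · exact he0.ne' (by exact_mod_cast h1)
  · exact HahnSeries.coeff_orderTop_ne he.symm h1

theorem euler_C (a : ℂ) : euler (HahnSeries.C a) = 0 := by
  ext e
  rw [coeff_euler, HahnSeries.C_apply, HahnSeries.coeff_zero]
  by_cases h : e = 0
  · simp [h]
  · rw [HahnSeries.coeff_single_of_ne h, mul_zero]

theorem euler_yArc : euler yArc = yArc := by
  ext e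
  rw [coeff_euler, yArc]
  by_cases h : e = 1
  · simp [h]
  · rw [HahnSeries.coeff_single_of_ne h, mul_zero]

theorem le_order_pderiv {F : Series2} {N : ℕ} (hF : ((N + 1 : ℕ) : ℕ∞) ≤ F.order) (i : Fin 2) :
    (N : ℕ∞) ≤ (MvPowerSeries.pderiv ℂ i F).order := by
  apply MvPowerSeries.nat_le_order
  intro d hd
  rw [MvPowerSeries.coeff_pderiv, MvPowerSeries.coeff_of_lt_order, zero_mul]
  refine lt_of_lt_of_le ?_ hF
  rw [map_add, Finsupp.degree_single]
  exact_mod_cast Nat.add_lt_add_right hd 1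

/-- The chain rule for the substitution of an arc. -/
theorem euler_evalArc {γ : HahnSeries ℚ ℂ} (hγ : 0 < γ.orderTop) (F : Series2) :
    euler (evalArc F γ) = evalArc (MvPowerSeries.pderiv ℂ 0 F) γ * euler γ +
      yArc * evalArc (MvPowerSeries.pderiv ℂ 1 F) γ := by
  obtain ⟨δ, hδ, hδ1, hδγ⟩ := exists_pos_le_orderTop hγ
  let Ψ : Series2 →+ HahnSeries ℚ ℂ := AddMonoidHom.mk'
    (fun F => euler (evalArc F γ) - (evalArc (MvPowerSeries.pderiv ℂ 0 F) γ * euler γ +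
      yArc * evalArc (MvPowerSeries.pderiv ℂ 1 F) γ)) (by
      intro a b
      simp only [evalArc_add, map_add, euler_add]
      ring)
  refine sub_eq_zero.mp (eq_zero_of_forall_coe Ψ ?_ hδ ?_ F)
  · intro p
    refine sub_eq_zero.mpr ?_
    induction p using MvPolynomial.induction_on with
    | C a =>
      have h0 : evalArc (0 : Series2) γ = 0 := evalArc_zero γ
      rw [MvPolynomial.coe_C, MvPowerSeries.pderiv_C, MvPowerSeries.pderiv_C, h0,
        ← MvPolynomial.coe_C, evalArc_coe hγ, MvPolynomial.eval₂_C, euler_C]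
      simp
    | add p q hp hq =>
      simp only [MvPolynomial.coe_add, evalArc_add, map_add, euler_add, hp, hq]
      ring
    | mul_X p i hp =>
      rw [MvPolynomial.coe_mul, evalArc_mul hγ, euler_mul, hp, MvPolynomial.coe_X]
      simp only [Derivation.leibniz, smul_eq_mul, evalArc_add, evalArc_mul hγ]
      have h1 : evalArc (1 : Series2) γ = 1 := map_one (evalHom γ hγ)
      have h0 : evalArc (0 : Series2) γ = 0 := evalArc_zero γ
      fin_cases i
      · have hX := evalArc_X_zero hγ
        simp only [Fin.mk_zero, hX, MvPowerSeries.pderiv_X_self,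
          MvPowerSeries.pderiv_X_of_ne (zero_ne_one' (Fin 2)), h1, h0]
        ring
      · have hX := evalArc_X_one hγ
        simp only [Fin.mk_one, hX, MvPowerSeries.pderiv_X_self,
          MvPowerSeries.pderiv_X_of_ne (zero_ne_one' (Fin 2)).symm, h1, h0, euler_yArc]
        ring
  · intro N F hF
    have hd : ∀ i, ((δ * N : ℚ) : WithTop ℚ) ≤ (evalArc (MvPowerSeries.pderiv ℂ i F) γ).orderTop :=
      fun i => le_orderTop_evalArc hδ.le hδ1 hγ hδγ (le_order_pderiv hF i)
    refine coe_le_orderTop_sub ?_ (le_trans (le_min ?_ ?_) HahnSeries.min_orderTop_le_orderTop_add)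
    · exact (le_orderTop_evalArc hδ.le hδ1 hγ hδγ
        (le_trans (by exact_mod_cast N.le_succ) hF)).trans (orderTop_le_orderTop_euler _)
    · have := coe_add_le_orderTop_mul (hd 0) (b := 0) (y := euler γ)
        (by simpa using hγ.le.trans (orderTop_le_orderTop_euler _))
      simpa using this
    · have := coe_add_le_orderTop_mul (a := 0) (x := yArc) (by simpa using orderTop_yArc_pos.le)
        (hd 1)
      simpa using this

/-- The Jacobian along an arc. -/
theorem yArc_mul_evalArc_jacobian {γ : HahnSeries ℚ ℂ} (hγ : 0 < γ.orderTop) (f g : Series2) :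
    yArc * evalArc (jacobian f g) γ =
      euler (evalArc f γ) * evalArc (MvPowerSeries.pderiv ℂ 0 g) γ -
        evalArc (MvPowerSeries.pderiv ℂ 0 f) γ * euler (evalArc g γ) := by
  rw [euler_evalArc hγ, euler_evalArc hγ, jacobian, ← evalHom_apply hγ, map_sub, map_mul, map_mul]
  simp only [evalHom_apply]
  ring

end EulerDerivation

end TreeModel

end

noncomputable section

namespace TreeModel

/-! ### Series in `x` and `y` as series in `x` over series in `y` -/

section Nested

/-- The power series in two variables given by a power series in `x` over those in `y`. -/
def unnest (G : PowerSeries (PowerSeries ℂ)) : Series2 :=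
  fun n => PowerSeries.coeff (n 1) (PowerSeries.coeff (n 0) G)

theorem coeff_unnest (G : PowerSeries (PowerSeries ℂ)) (n : Fin 2 →₀ ℕ) :
    MvPowerSeries.coeff n (unnest G) = PowerSeries.coeff (n 1) (PowerSeries.coeff (n 0) G) :=
  rfl

/-- Power series in `x` over the power series in `y`. -/
def nestedEquiv : PowerSeries (PowerSeries ℂ) ≃+* Series2 where
  toFun := unnest
  invFun F := PowerSeries.mk fun i => PowerSeries.mk fun j =>
    MvPowerSeries.coeff (Finsupp.single 0 i + Finsupp.single 1 j) F
  left_inv G := by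
    ext i j
    simp [coeff_unnest]
  right_inv F := by
    ext n
    have : Finsupp.single 0 (n 0) + Finsupp.single 1 (n 1) = n := by
      ext i; fin_cases i <;> simp
    rw [coeff_unnest]
    simp [this]
  map_mul' G H := by
    ext n
    rw [MvPowerSeries.coeff_mul, coeff_unnest, PowerSeries.coeff_mul, map_sum]
    simp_rw [PowerSeries.coeff_mul, coeff_unnest]
    rw [← Finset.sum_product']
    refine Finset.sum_nbij'
      (fun p => (Finsupp.single 0 p.1.1 + Finsupp.single 1 p.2.1,
        Finsupp.single 0 p.1.2 + Finsupp.single 1 p.2.2))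
      (fun q => ((q.1 0, q.2 0), (q.1 1, q.2 1))) ?_ ?_ ?_ ?_ ?_
    · rintro ⟨⟨a, b⟩, ⟨c, d⟩⟩ h
      simp only [Finset.mem_product, Finset.HasAntidiagonal.mem_antidiagonal] at h ⊢
      ext i
      fin_cases i <;> simp [h.1, h.2]
    · rintro ⟨p, q⟩ h
      simp only [Finset.mem_product, Finset.HasAntidiagonal.mem_antidiagonal] at h ⊢
      simp [← h]
    · rintro ⟨⟨a, b⟩, ⟨c, d⟩⟩ _
      simp
    · rintro ⟨p, q⟩ _
      simp only [Prod.mk.injEq]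
      constructor <;> ext i <;> fin_cases i <;> simp
    · rintro ⟨⟨a, b⟩, ⟨c, d⟩⟩ _
      simp
  map_add' G H := by
    ext n
    simp [coeff_unnest]

theorem coeff_nestedEquiv (G : PowerSeries (PowerSeries ℂ)) (n : Fin 2 →₀ ℕ) :
    MvPowerSeries.coeff n (nestedEquiv G) = PowerSeries.coeff (n 1) (PowerSeries.coeff (n 0) G) :=
  rfl

theorem nestedEquiv_X : nestedEquiv PowerSeries.X = MvPowerSeries.X 0 := by
  ext n
  rw [coeff_nestedEquiv, PowerSeries.coeff_X, MvPowerSeries.coeff_X]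
  have : n = Finsupp.single 0 1 ↔ n 0 = 1 ∧ n 1 = 0 := by
    simp [Finsupp.ext_iff, Fin.forall_fin_two]
  by_cases h : n 0 = 1 <;> simp [this, h, PowerSeries.coeff_one]

theorem nestedEquiv_C_X : nestedEquiv (PowerSeries.C PowerSeries.X) = MvPowerSeries.X 1 := by
  ext n
  rw [coeff_nestedEquiv, PowerSeries.coeff_C, MvPowerSeries.coeff_X]
  have : n = Finsupp.single 1 1 ↔ n 0 = 0 ∧ n 1 = 1 := by
    simp [Finsupp.ext_iff, Fin.forall_fin_two]
  by_cases h : n 0 = 0 <;> simp [this, h, PowerSeries.coeff_X]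

theorem pderiv_nestedEquiv (G : PowerSeries (PowerSeries ℂ)) :
    MvPowerSeries.pderiv ℂ 0 (nestedEquiv G) =
      nestedEquiv (PowerSeries.derivative (PowerSeries ℂ) G) := by
  ext n
  rw [MvPowerSeries.coeff_pderiv, coeff_nestedEquiv, coeff_nestedEquiv,
    PowerSeries.coeff_derivative]
  have : ((n 0 : PowerSeries ℂ) + 1) = PowerSeries.C ((n 0 : ℂ) + 1) := by simp
  rw [this, PowerSeries.coeff_mul_C]
  simp

theorem pderiv_iterate_nestedEquiv_coe (P : Polynomial (PowerSeries ℂ)) (k : ℕ) :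
    (MvPowerSeries.pderiv ℂ 0)^[k] (nestedEquiv P) =
      nestedEquiv (Polynomial.derivative^[k] P : Polynomial (PowerSeries ℂ)) := by
  induction k with
  | zero => rfl
  | succ k ih =>
    rw [Function.iterate_succ_apply', ih, pderiv_nestedEquiv, PowerSeries.derivative_coe,
      Function.iterate_succ_apply']

/-- The common power of `y` in a non-zero power series. -/
theorem exists_eq_C_X_pow_mul {G : PowerSeries (PowerSeries ℂ)} (hG : G ≠ 0) :
    ∃ (e : ℕ) (H : PowerSeries (PowerSeries ℂ)),
      G = PowerSeries.C PowerSeries.X ^ e * H ∧ H.map (IsLocalRing.residue _) ≠ 0 := by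
  classical
  have hex : ∃ n i, PowerSeries.coeff i G ≠ 0 ∧ (PowerSeries.coeff i G).order.toNat = n := by
    by_contra! h
    exact hG (PowerSeries.ext fun i => by
      rw [map_zero]
      by_contra h'
      exact h _ i h' rfl)
  obtain ⟨i₀, hi₀, he⟩ := Nat.find_spec hex
  set e := Nat.find hex
  have hdvd : ∀ i, ∃ b, PowerSeries.coeff i G = PowerSeries.X ^ e * b := by
    intro i
    by_cases h : PowerSeries.coeff i G = 0
    · exact ⟨0, by simp [h]⟩
    · exact (pow_dvd_pow _ (Nat.find_min' hex ⟨i, h, rfl⟩)).trans PowerSeries.X_pow_order_dvd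
  choose b hb using hdvd
  refine ⟨e, PowerSeries.mk b, ?_, ?_⟩
  · ext1 i
    rw [← map_pow, PowerSeries.coeff_C_mul, PowerSeries.coeff_mk, hb]
  · intro h
    have h1 := congrArg (PowerSeries.coeff i₀) h
    rw [PowerSeries.coeff_map, PowerSeries.coeff_mk, map_zero,
      constantCoeff_eq_zero_iff_residue] at h1
    have h2 := PowerSeries.coeff_order hi₀
    rw [he, hb, PowerSeries.coeff_X_pow_mul', if_pos le_rfl, Nat.sub_self,
      PowerSeries.coeff_zero_eq_constantCoeff_apply] at h2
    exact h2 h1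

end Nested

/-! ### Substitution of `y ^ (1 / D)` -/

section RootSubst

/-- The order embedding of the exponents of `t` into those of `y = t ^ D`. -/
def divHom (D : ℕ) : ℕ →+ ℚ where
  toFun n := (n : ℚ) / D
  map_zero' := by simp
  map_add' m n := by push_cast; ring

/-- The substitution of `y ^ (1 / D)` in a power series. -/
def rootSubst (D : ℕ) (hD : D ≠ 0) : PowerSeries ℂ →+* HahnSeries ℚ ℂ :=
  (HahnSeries.embDomainRingHom (divHom D)
    (fun m n h => by
      have hD' : (D : ℚ) ≠ 0 := by exact_mod_cast hD
      have : (m : ℚ) / D = n / D := h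
      field_simp at this
      exact_mod_cast this)
    (fun m n => by
      have hD' : (0 : ℚ) < D := by exact_mod_cast Nat.pos_of_ne_zero hD
      change (m : ℚ) / D ≤ n / D ↔ _
      rw [div_le_div_iff_of_pos_right hD']
      exact Nat.cast_le)).comp
    (HahnSeries.toPowerSeries (R := ℂ)).symm.toRingHom

theorem coeff_rootSubst {D : ℕ} (hD : D ≠ 0) (a : PowerSeries ℂ) (n : ℕ) :
    (rootSubst D hD a).coeff ((n : ℚ) / D) = PowerSeries.coeff n a := by
  have := HahnSeries.embDomain_coeff (f := ⟨⟨divHom D, fun m n h => by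
      have hD' : (D : ℚ) ≠ 0 := by exact_mod_cast hD
      have : (m : ℚ) / D = n / D := h
      field_simp at this
      exact_mod_cast this⟩, by
      intro m n
      have hD' : (0 : ℚ) < D := by exact_mod_cast Nat.pos_of_ne_zero hD
      change (m : ℚ) / D ≤ n / D ↔ _
      rw [div_le_div_iff_of_pos_right hD']
      exact Nat.cast_le⟩) (x := (HahnSeries.toPowerSeries (R := ℂ)).symm a) (a := n)
  rw [HahnSeries.coeff_toPowerSeries_symm] at this
  exact this

theorem coeff_rootSubst_of_notMem {D : ℕ} (hD : D ≠ 0) (a : PowerSeries ℂ) {e : ℚ}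
    (he : ∀ n : ℕ, e ≠ (n : ℚ) / D) : (rootSubst D hD a).coeff e = 0 := by
  apply HahnSeries.embDomain_of_notMem_range
  rintro ⟨n, hn⟩
  exact he n hn.symm

/-- Since `(y ^ (1 / D)) ^ D = y`, a splitting obtained after `t ↦ t ^ D` becomes a splitting over
the Hahn series for the original variable. -/
theorem rootSubst_expandHom {D : ℕ} (hD : D ≠ 0) (a : PowerSeries ℂ) :
    rootSubst D hD (expandHom D hD a) = rootSubst 1 one_ne_zero a := by
  have hD' : (D : ℚ) ≠ 0 := by exact_mod_cast hD
  ext e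
  by_cases he : ∃ n : ℕ, e = n
  · obtain ⟨n, rfl⟩ := he
    have h1 := coeff_rootSubst one_ne_zero a n
    have h2 := coeff_rootSubst hD (expandHom D hD a) (D * n)
    rw [expandHom_apply, PowerSeries.coeff_expand_mul] at h2
    rw [Nat.cast_one, div_one] at h1
    rw [h1, ← h2]
    congr 1
    push_cast
    field_simp
  · push Not at he
    rw [coeff_rootSubst_of_notMem one_ne_zero _ (by simpa using he)]
    by_cases he' : ∃ n : ℕ, e = (n : ℚ) / D
    · obtain ⟨n, rfl⟩ := he'
      rw [coeff_rootSubst, expandHom_apply, PowerSeries.coeff_expand_of_not_dvd]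
      rintro ⟨k, rfl⟩
      refine he k ?_
      push_cast
      field_simp
    · push Not at he'
      exact coeff_rootSubst_of_notMem _ _ he'

theorem lt_orderTop_iff {x : HahnSeries ℚ ℂ} {a : ℚ} :
    (a : WithTop ℚ) < x.orderTop ↔ ∀ e ≤ a, x.coeff e = 0 := by
  refine ⟨fun h e he => HahnSeries.coeff_eq_zero_of_lt_orderTop
    (lt_of_le_of_lt (by exact_mod_cast he) h), fun h => ?_⟩
  by_contra! hle
  obtain ⟨b, hb⟩ := WithTop.ne_top_iff_exists.mp (ne_top_of_le_ne_top WithTop.coe_ne_top hle)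
  rw [← hb] at hle
  exact HahnSeries.coeff_orderTop_ne hb.symm (h b (by exact_mod_cast hle))

theorem isArc_rootSubst {D : ℕ} (hD : D ≠ 0) {a : PowerSeries ℂ}
    (ha : PowerSeries.constantCoeff a = 0) : IsArc (rootSubst D hD a) := by
  have hD' : (0 : ℚ) < D := by exact_mod_cast Nat.pos_of_ne_zero hD
  refine ⟨?_, D, Nat.pos_of_ne_zero hD, fun e he => ?_⟩
  · refine lt_orderTop_iff.mpr fun e he => ?_
    by_cases he' : ∃ n : ℕ, e = (n : ℚ) / D
    · obtain ⟨n, rfl⟩ := he'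
      have : (n : ℚ) ≤ 0 := by
        by_contra! h
        exact absurd he (not_le.mpr (div_pos h hD'))
      have hn : n = 0 := by exact_mod_cast le_antisymm this (Nat.cast_nonneg n)
      rw [coeff_rootSubst, hn, PowerSeries.coeff_zero_eq_constantCoeff_apply, ha]
    · push Not at he'
      exact coeff_rootSubst_of_notMem _ _ he'
  · by_contra! h
    exact he (coeff_rootSubst_of_notMem hD a h)

theorem evalArc_nestedEquiv_C {γ : HahnSeries ℚ ℂ} (hγ : 0 < γ.orderTop) (a : PowerSeries ℂ) :
    evalArc (nestedEquiv (PowerSeries.C a)) γ = rootSubst 1 one_ne_zero a := by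
  ext e
  rw [coeff_evalArc _ hγ]
  have hy : ∀ j : ℕ, yArc ^ j = HahnSeries.single (j : ℚ) (1 : ℂ) := by
    intro j
    rw [yArc, HahnSeries.single_pow]
    simp
  have hz : ∀ ij : ℕ × ℕ, ¬ (ij.1 = 0 ∧ (ij.2 : ℚ) = e) →
      MvPowerSeries.coeff (Finsupp.single 0 ij.1 + Finsupp.single 1 ij.2)
        (nestedEquiv (PowerSeries.C a)) * (γ ^ ij.1 * yArc ^ ij.2).coeff e = 0 := by
    rintro ⟨i, j⟩ hij
    rw [coeff_nestedEquiv, PowerSeries.coeff_C]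
    by_cases hi : i = 0
    · have hj : (j : ℚ) ≠ e := fun h => hij ⟨hi, h⟩
      simp [hi, hy, HahnSeries.coeff_single_of_ne hj.symm]
    · simp [hi]
  by_cases he : ∃ n : ℕ, e = n
  · obtain ⟨n, rfl⟩ := he
    have h1 := coeff_rootSubst one_ne_zero a n
    rw [Nat.cast_one, div_one] at h1
    rw [h1, finsum_eq_single _ (0, n), coeff_nestedEquiv, PowerSeries.coeff_C]
    · simp [hy]
    · rintro ⟨i, j⟩ hij
      apply hz
      rintro ⟨h, h'⟩
      exact hij (by simp only at h h'; rw [h, Nat.cast_inj.mp h'])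
  · push Not at he
    rw [coeff_rootSubst_of_notMem one_ne_zero _ (by simpa using he)]
    exact finsum_eq_zero_of_forall_eq_zero fun ij => hz ij fun h => he _ h.2.symm

theorem evalArc_nestedEquiv_coe {γ : HahnSeries ℚ ℂ} (hγ : 0 < γ.orderTop)
    (P : Polynomial (PowerSeries ℂ)) :
    evalArc (nestedEquiv P) γ = (P.map (rootSubst 1 one_ne_zero)).eval γ := by
  have : ((evalHom γ hγ).comp (nestedEquiv : PowerSeries (PowerSeries ℂ) →+* Series2)).comp
      Polynomial.coeToPowerSeries.ringHom =
      (Polynomial.evalRingHom γ).comp (Polynomial.mapRingHom (rootSubst 1 one_ne_zero)) := by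
    apply Polynomial.ringHom_ext
    · intro a
      simp [evalHom_apply, evalArc_nestedEquiv_C hγ]
    · simp [evalHom_apply, nestedEquiv_X, evalArc_X_zero hγ]
  exact congrArg (fun φ => φ P) this

end RootSubst

/-! ### The Newton-Puiseux factorization -/

section Factorization

/-- The Leibniz rule at a zero of order at least `n`. -/
theorem map_iterate_derivation_mul {A K : Type*} [CommRing A] [Algebra ℂ A] [CommRing K]
    (D : Derivation ℂ A A) (φ : A →+* K) (n : ℕ) (V P : A) (hP : ∀ k < n, φ (D^[k] P) = 0) :
    (∀ k < n, φ (D^[k] (V * P)) = 0) ∧ φ (D^[n] (V * P)) = φ V * φ (D^[n] P) := by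
  induction n generalizing V P with
  | zero => simp
  | succ n ih =>
    have hadd : ∀ (k : ℕ) (a b : A), D^[k] (a + b) = D^[k] a + D^[k] b := fun k a b =>
      iterate_map_add D k a b
    have h1 := ih (D V) P fun k hk => hP k (by omega)
    have h2 := ih V (D P) fun k hk => by
      rw [← Function.iterate_succ_apply]; exact hP (k + 1) (by omega)
    have hD : ∀ k, φ (D^[k + 1] (V * P)) = φ (D^[k] (V * D P)) + φ (D^[k] (D V * P)) := by
      intro k
      rw [Function.iterate_succ_apply, Derivation.leibniz, smul_eq_mul, smul_eq_mul, hadd,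
        map_add, mul_comm P]
    constructor
    · rintro (_ | k) hk
      · have := hP 0 (by omega)
        simp only [Function.iterate_zero, id] at this ⊢
        rw [map_mul, this, mul_zero]
      · rw [hD, h1.1 k (by omega), h2.1 k (by omega), add_zero]
    · rw [hD, h1.2, h2.2, hP n (by omega), mul_zero, add_zero, Function.iterate_succ_apply]

/-- The monic polynomial with given roots. -/
def rootsPoly {K : Type*} [CommRing K] (S : Multiset K) : Polynomial K :=
  (S.map fun a => Polynomial.X - Polynomial.C a).prod

/-- The Newton-Puiseux factorization `F = y ^ e * U * ∏ (x - λ)` along arcs. -/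
structure IsPuiseuxFactorization (F : Series2) (e : ℕ) (U : Series2)
    (S : Multiset (HahnSeries ℚ ℂ)) : Prop where
  unit : MvPowerSeries.constantCoeff U ≠ 0
  isArc : ∀ γ ∈ S, IsArc γ
  eval_eq : ∀ γ : HahnSeries ℚ ℂ, 0 < γ.orderTop →
    evalArc F γ = yArc ^ e * evalArc U γ * (rootsPoly S).eval γ
  eval_pderiv : ∀ γ : HahnSeries ℚ ℂ, 0 < γ.orderTop →
    evalArc (MvPowerSeries.pderiv ℂ 0 F) γ =
      yArc ^ e * (evalArc (MvPowerSeries.pderiv ℂ 0 U) γ * (rootsPoly S).eval γ +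
        evalArc U γ * (rootsPoly S).derivative.eval γ)
  rootMult_eq : ∀ γ : HahnSeries ℚ ℂ, 0 < γ.orderTop →
    rootMult F γ = (rootsPoly S).rootMultiplicity γ

theorem yArc_ne_zero : yArc ≠ 0 := by
  intro h
  have := orderTop_yArc
  rw [h, HahnSeries.orderTop_zero] at this
  exact absurd this (by decide)

theorem evalArc_ne_zero_of_constantCoeff {γ : HahnSeries ℚ ℂ} (hγ : 0 < γ.orderTop)
    {U : Series2} (hU : MvPowerSeries.constantCoeff U ≠ 0) : evalArc U γ ≠ 0 := by
  have h : IsUnit U := MvPowerSeries.isUnit_iff_constantCoeff.mpr (isUnit_iff_ne_zero.mpr hU)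
  exact (h.map (evalHom γ hγ)).ne_zero

theorem rootsPoly_monic {K : Type*} [CommRing K] (S : Multiset K) : (rootsPoly S).Monic :=
  Polynomial.monic_multisetProd_X_sub_C S

/-- The **Newton-Puiseux theorem** for power series in two variables. -/
theorem exists_isPuiseuxFactorization {F : Series2} (hF : F ≠ 0) :
    ∃ e U S, IsPuiseuxFactorization F e U S := by
  have hG : nestedEquiv.symm F ≠ 0 := by simpa using hF
  obtain ⟨e, H, hGH, hH⟩ := exists_eq_C_X_pow_mul hG
  obtain ⟨P, h, hfac⟩ := PowerSeries.exists_isWeierstrassFactorization hH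
  have hPm : P.Monic := hfac.isDistinguishedAt.monic
  obtain ⟨D, hD, hsplit⟩ := splitsAfterExpand_of_monic P hPm
  set R := (P.map (expandHom D hD)).roots with hR
  set S := R.map (rootSubst D hD) with hS
  have hPK : P.map (rootSubst 1 one_ne_zero) = rootsPoly S := by
    have h1 : P.map (rootSubst 1 one_ne_zero) =
        (P.map (expandHom D hD)).map (rootSubst D hD) := by
      rw [Polynomial.map_map]
      congr 1
      ext1 a
      exact (rootSubst_expandHom hD a).symm
    rw [h1, hsplit.eq_prod_roots_of_monic (hPm.map _), ← hR, rootsPoly, hS,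
      Polynomial.map_multiset_prod, Multiset.map_map, Multiset.map_map]
    congr 1
    refine Multiset.map_congr rfl fun a _ => ?_
    simp
  have hFeq : F = MvPowerSeries.X 1 ^ e * nestedEquiv h * nestedEquiv P := by
    rw [← nestedEquiv.apply_symm_apply F, hGH, hfac.eq_mul]
    simp only [map_mul, map_pow, nestedEquiv_C_X]
    ring
  have hU : MvPowerSeries.constantCoeff (nestedEquiv h) ≠ 0 :=
    (MvPowerSeries.isUnit_iff_constantCoeff.mp (hfac.isUnit.map nestedEquiv)).ne_zero
  have hev : ∀ (k : ℕ) (γ : HahnSeries ℚ ℂ), 0 < γ.orderTop →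
      evalArc ((MvPowerSeries.pderiv ℂ 0)^[k] (nestedEquiv P)) γ =
        (Polynomial.derivative^[k] (rootsPoly S)).eval γ := by
    intro k γ hγ
    rw [pderiv_iterate_nestedEquiv_coe, evalArc_nestedEquiv_coe hγ, ← hPK,
      Polynomial.iterate_derivative_map]
  refine ⟨e, nestedEquiv h, S, hU, ?_, ?_, ?_, ?_⟩
  · intro γ hγ
    obtain ⟨r, hr, rfl⟩ := Multiset.mem_map.mp hγ
    apply isArc_rootSubst
    have hroot : (P.map (expandHom D hD)).IsRoot r := Polynomial.isRoot_of_mem_roots hr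
    have h1 := congrArg (PowerSeries.constantCoeff (R := ℂ)) hroot
    rw [Polynomial.eval_map, Polynomial.hom_eval₂, map_zero] at h1
    have h2 : (PowerSeries.constantCoeff (R := ℂ)).comp (expandHom D hD) =
        PowerSeries.constantCoeff := by
      ext1 a
      exact PowerSeries.constantCoeff_expand D hD a
    -- A distinguished polynomial reduces to a power of `x`. Hence its roots have zero constant term
    -- and give arcs of positive order.
    have h3 : P.map (PowerSeries.constantCoeff (R := ℂ)) = Polynomial.X ^ P.natDegree := by
      ext1 i
      rw [Polynomial.coeff_map, Polynomial.coeff_X_pow]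
      split_ifs with hi
      · rw [hi, hPm.coeff_natDegree, map_one]
      · rcases lt_or_gt_of_ne hi with hi | hi
        · have := hfac.isDistinguishedAt.mem hi
          rwa [PowerSeries.maximalIdeal_eq_span_X, Ideal.mem_span_singleton,
            PowerSeries.X_dvd_iff] at this
        · rw [Polynomial.coeff_eq_zero_of_natDegree_lt hi, map_zero]
    rw [h2, ← Polynomial.eval_map, h3, Polynomial.eval_pow, Polynomial.eval_X] at h1
    exact eq_zero_of_pow_eq_zero h1
  · intro γ hγ
    have h0 := hev 0 γ hγ
    simp only [Function.iterate_zero, id] at h0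
    conv_lhs => rw [hFeq]
    rw [evalArc_mul hγ, evalArc_mul hγ, h0, ← evalHom_apply hγ (MvPowerSeries.X 1 ^ e), map_pow,
      evalHom_apply, evalArc_X_one hγ]
  · intro γ hγ
    have h0 := hev 0 γ hγ
    have h1 := hev 1 γ hγ
    simp only [Function.iterate_zero, Function.iterate_one, id] at h0 h1
    have hX : MvPowerSeries.pderiv ℂ 0 ((MvPowerSeries.X 1 : Series2) ^ e) = 0 := by
      rw [MvPowerSeries.pderiv_pow, MvPowerSeries.pderiv_X_of_ne (by decide), mul_zero]
    have hXe : evalArc ((MvPowerSeries.X 1 : Series2) ^ e) γ = yArc ^ e := by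
      rw [← evalHom_apply hγ, map_pow, evalHom_apply, evalArc_X_one hγ]
    conv_lhs => rw [hFeq]
    simp only [Derivation.leibniz, smul_eq_mul, hX, mul_zero, add_zero, evalArc_add,
      evalArc_mul hγ, h0, h1, hXe]
    ring
  · intro γ hγ
    have hne : rootsPoly S ≠ 0 := (rootsPoly_monic S).ne_zero
    set m := (rootsPoly S).rootMultiplicity γ with hm
    have hlow : ∀ k < m, evalHom γ hγ ((MvPowerSeries.pderiv ℂ 0)^[k] (nestedEquiv P)) = 0 := by
      intro k hk
      rw [evalHom_apply, hev k γ hγ]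
      exact Polynomial.isRoot_iterate_derivative_of_lt_rootMultiplicity hk
    -- The cofactor `y ^ e * h` does not vanish along `γ`, so `F` and `P` have the same first
    -- nonvanishing `x`-derivative there.
    have key := map_iterate_derivation_mul (MvPowerSeries.pderiv ℂ 0) (evalHom γ hγ) m
      (MvPowerSeries.X 1 ^ e * nestedEquiv h) (nestedEquiv P) hlow
    rw [← hFeq] at key
    have htop : evalArc ((MvPowerSeries.pderiv ℂ 0)^[m] F) γ ≠ 0 := by
      rw [← evalHom_apply hγ, key.2, map_mul, map_pow, evalHom_apply, evalHom_apply,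
        evalHom_apply, hev m γ hγ, evalArc_X_one hγ]
      refine mul_ne_zero (mul_ne_zero (pow_ne_zero _ yArc_ne_zero)
        (evalArc_ne_zero_of_constantCoeff hγ hU)) ?_
      rw [hm, Polynomial.eval_iterate_derivative_rootMultiplicity, nsmul_eq_mul]
      refine mul_ne_zero ?_ ?_
      · rw [← HahnSeries.single_zero_natCast]
        simp [Nat.factorial_ne_zero]
      · exact Polynomial.eval_divByMonic_pow_rootMultiplicity_ne_zero γ hne
    apply le_antisymm (Nat.sInf_le htop)
    by_contra! hlt
    exact Nat.sInf_mem (s := {n | evalArc ((MvPowerSeries.pderiv ℂ 0)^[n] F) γ ≠ 0})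
      ⟨m, htop⟩ (key.1 _ hlt)

end Factorization

end TreeModel

end

noncomputable section

namespace TreeModel

/-! ### Leading terms -/

section Lead

/-- The series has no terms of exponent less than `ν`, and its coefficient at `ν` is `a`
(possibly zero). -/
def HasLead (x : HahnSeries ℚ ℂ) (ν : ℚ) (a : ℂ) : Prop :=
  (∀ e < ν, x.coeff e = 0) ∧ x.coeff ν = a

theorem hasLead_iff {x : HahnSeries ℚ ℂ} {ν : ℚ} {a : ℂ} :
    HasLead x ν a ↔ (ν : WithTop ℚ) < (x - HahnSeries.single ν a).orderTop := by
  rw [lt_orderTop_iff]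
  constructor
  · rintro ⟨h, h'⟩ e he
    rw [HahnSeries.coeff_sub]
    rcases he.lt_or_eq with he | rfl
    · rw [h e he, HahnSeries.coeff_single_of_ne he.ne, sub_zero]
    · rw [h', HahnSeries.coeff_single_same, sub_self]
  · intro h
    refine ⟨fun e he => ?_, ?_⟩
    · have := h e he.le
      rwa [HahnSeries.coeff_sub, HahnSeries.coeff_single_of_ne he.ne, sub_zero] at this
    · have := h ν le_rfl
      rwa [HahnSeries.coeff_sub, HahnSeries.coeff_single_same, sub_eq_zero] at this

theorem HasLead.le_orderTop {x : HahnSeries ℚ ℂ} {ν : ℚ} {a : ℂ} (h : HasLead x ν a) :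
    (ν : WithTop ℚ) ≤ x.orderTop := by
  rw [HahnSeries.le_orderTop_iff_forall]
  intro e he
  exact h.1 e (by exact_mod_cast he)

theorem lt_orderTop_mul_of_lt_of_le {x y : HahnSeries ℚ ℂ} {a b : ℚ}
    (hx : (a : WithTop ℚ) < x.orderTop) (hy : (b : WithTop ℚ) ≤ y.orderTop) :
    ((a + b : ℚ) : WithTop ℚ) < (x * y).orderTop := by
  refine lt_of_lt_of_le ?_ HahnSeries.orderTop_add_le_mul
  rw [WithTop.coe_add]
  exact WithTop.add_lt_add_of_lt_of_le WithTop.coe_ne_top hx hy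

theorem HasLead.mul {x y : HahnSeries ℚ ℂ} {ν μ : ℚ} {a b : ℂ} (hx : HasLead x ν a)
    (hy : HasLead y μ b) : HasLead (x * y) (ν + μ) (a * b) := by
  rw [hasLead_iff]
  have h1 := lt_orderTop_mul_of_lt_of_le (hasLead_iff.mp hx) hy.le_orderTop
  have h2 := lt_orderTop_mul_of_lt_of_le (hasLead_iff.mp hy)
    (y := HahnSeries.single ν a) HahnSeries.orderTop_single_le
  have h3 : x * y - HahnSeries.single (ν + μ) (a * b) =
      (x - HahnSeries.single ν a) * y +
        (y - HahnSeries.single μ b) * HahnSeries.single ν a := by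
    rw [← HahnSeries.single_mul_single]; ring
  rw [h3]
  rw [add_comm μ] at h2
  exact (lt_min h1 h2).trans_le HahnSeries.min_orderTop_le_orderTop_add

theorem HasLead.add {x y : HahnSeries ℚ ℂ} {ν : ℚ} {a b : ℂ} (hx : HasLead x ν a)
    (hy : HasLead y ν b) : HasLead (x + y) ν (a + b) :=
  ⟨fun e he => by rw [HahnSeries.coeff_add, hx.1 e he, hy.1 e he, add_zero],
    by rw [HahnSeries.coeff_add, hx.2, hy.2]⟩

theorem HasLead.sub {x y : HahnSeries ℚ ℂ} {ν : ℚ} {a b : ℂ} (hx : HasLead x ν a)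
    (hy : HasLead y ν b) : HasLead (x - y) ν (a - b) :=
  ⟨fun e he => by rw [HahnSeries.coeff_sub, hx.1 e he, hy.1 e he, sub_zero],
    by rw [HahnSeries.coeff_sub, hx.2, hy.2]⟩

theorem HasLead.of_lt {x : HahnSeries ℚ ℂ} {ν μ : ℚ} {a : ℂ} (hx : HasLead x ν a)
    (h : μ < ν) : HasLead x μ 0 :=
  ⟨fun e he => hx.1 e (he.trans h), hx.1 μ h⟩

theorem HasLead.euler {x : HahnSeries ℚ ℂ} {ν : ℚ} {a : ℂ} (hx : HasLead x ν a) :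
    HasLead (euler x) ν (ν * a) :=
  ⟨fun e he => by rw [coeff_euler, hx.1 e he, mul_zero], by rw [coeff_euler, hx.2]⟩

theorem HasLead.le_of_ne {x : HahnSeries ℚ ℂ} {ν μ : ℚ} {a b : ℂ} (hx : HasLead x ν a)
    (hy : HasLead x μ b) (ha : a ≠ 0) : μ ≤ ν := by
  by_contra! h
  exact ha (hx.2.symm.trans (hy.1 ν h))

theorem HasLead.orderTop_eq {x : HahnSeries ℚ ℂ} {ν : ℚ} {a : ℂ} (hx : HasLead x ν a)
    (ha : a ≠ 0) : x.orderTop = ν :=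
  le_antisymm (HahnSeries.orderTop_le_of_coeff_ne_zero (by rw [hx.2]; exact ha)) hx.le_orderTop

theorem hasLead_one : HasLead 1 0 1 :=
  ⟨fun e he => by rw [HahnSeries.coeff_one, if_neg he.ne], by rw [HahnSeries.coeff_one, if_pos rfl]⟩

theorem hasLead_zero (ν : ℚ) : HasLead 0 ν 0 :=
  ⟨fun _ _ => rfl, rfl⟩

theorem hasLead_yArc_pow (e : ℕ) : HasLead (yArc ^ e) e 1 := by
  rw [hasLead_iff, yArc, HahnSeries.single_pow]
  simp

theorem hasLead_evalArc {γ : HahnSeries ℚ ℂ} (hγ : 0 < γ.orderTop) (U : Series2) :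
    HasLead (evalArc U γ) 0 (MvPowerSeries.constantCoeff U) := by
  rw [hasLead_iff]
  have h1 : evalArc (MvPowerSeries.C (MvPowerSeries.constantCoeff U)) γ =
      HahnSeries.single 0 (MvPowerSeries.constantCoeff U) := by
    rw [← MvPolynomial.coe_C, evalArc_coe hγ, MvPolynomial.eval₂_C]; rfl
  rw [← h1, ← evalHom_apply hγ, ← evalHom_apply hγ, ← map_sub, evalHom_apply]
  exact lt_orderTop_evalArc hγ (by simp)

end Lead

/-! ### Leading forms along a bar -/

section BarForm

/-- The arc agrees with the series of the bar below its height. -/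
def IsOver (B : Bar) (γ : HahnSeries ℚ ℂ) : Prop :=
  ∀ e < B.height, γ.coeff e = B.center.coeff e

theorem climbsAt_iff {γ : HahnSeries ℚ ℂ} {B : Bar} {a : ℂ} :
    ClimbsAt γ B a ↔ IsOver B γ ∧ γ.coeff B.height = a := Iff.rfl

/-- Bars of positive height whose series has positive order and no exponents from the height on. -/
structure IsAdmissible (B : Bar) : Prop where
  height_pos : 0 < B.height
  center_pos : 0 < B.center.orderTop
  coeff_center : ∀ e, B.height ≤ e → B.center.coeff e = 0

/-- The arc `λ_B + z y ^ h(B)`. -/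
def barArc (B : Bar) (z : ℂ) : HahnSeries ℚ ℂ := B.center + HahnSeries.single B.height z

variable {B : Bar}

theorem IsAdmissible.orderTop_barArc_pos (hB : IsAdmissible B) (z : ℂ) :
    0 < (barArc B z).orderTop := by
  refine lt_of_lt_of_le (lt_min hB.center_pos ?_) HahnSeries.min_orderTop_le_orderTop_add
  exact HahnSeries.lt_orderTop_single hB.height_pos

theorem IsAdmissible.hasLead_sub_of_isOver (hB : IsAdmissible B) {γ : HahnSeries ℚ ℂ}
    (h : IsOver B γ) (z : ℂ) : HasLead (barArc B z - γ) B.height (z - γ.coeff B.height) := by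
  refine ⟨fun e he => ?_, ?_⟩
  · rw [barArc, HahnSeries.coeff_sub, HahnSeries.coeff_add, HahnSeries.coeff_single_of_ne he.ne,
      h e he, add_zero, sub_self]
  · rw [barArc, HahnSeries.coeff_sub, HahnSeries.coeff_add, HahnSeries.coeff_single_same,
      hB.coeff_center _ le_rfl, zero_add]

/-- The arc separates from `λ_B` below the height, where the term `z y ^ h(B)` is not yet visible.
Both `κ` and `c` are therefore independent of `z`. -/
theorem exists_hasLead_sub_of_not_isOver {γ : HahnSeries ℚ ℂ} (h : ¬ IsOver B γ) :
    ∃ κ < B.height, ∃ c : ℂ, c ≠ 0 ∧ ∀ z, HasLead (barArc B z - γ) κ c := by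
  rw [IsOver] at h
  push Not at h
  obtain ⟨e, he, hne⟩ := h
  have hco : (B.center - γ).coeff e ≠ 0 := by
    rw [HahnSeries.coeff_sub, sub_ne_zero]; exact hne.symm
  have hx : B.center - γ ≠ 0 := by
    intro h0
    rw [h0] at hco
    exact hco rfl
  obtain ⟨κ, hκ⟩ := WithTop.ne_top_iff_exists.mp (HahnSeries.orderTop_ne_top.mpr hx)
  have hκe : κ ≤ e := by
    have := HahnSeries.orderTop_le_of_coeff_ne_zero hco
    rw [← hκ] at this
    exact_mod_cast this
  have hκh := hκe.trans_lt he
  have hlow : ∀ z, ∀ e' < B.height, (barArc B z - γ).coeff e' = (B.center - γ).coeff e' := by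
    intro z e' he'
    rw [barArc, HahnSeries.coeff_sub, HahnSeries.coeff_add, HahnSeries.coeff_single_of_ne he'.ne,
      add_zero, HahnSeries.coeff_sub]
  refine ⟨κ, hκh, _, HahnSeries.coeff_orderTop_ne hκ.symm, fun z => ⟨fun e' he' => ?_, ?_⟩⟩
  · rw [hlow z e' (he'.trans hκh)]
    apply HahnSeries.coeff_eq_zero_of_lt_orderTop
    rw [← hκ]
    exact_mod_cast he'
  · rw [hlow z κ hκh]

/-- The points of the bar at which members of a family of arcs climb over it. -/
def overCoeffs (B : Bar) (S : Multiset (HahnSeries ℚ ℂ)) : Multiset ℂ :=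
  by classical exact (S.filter (IsOver B)).map fun γ => γ.coeff B.height

/-- The orders and leading coefficients of a series and of its `x`-derivative along the arcs
`λ_B + z y ^ h(B)`. -/
structure HasBarForm (B : Bar) (x x' : ℂ → HahnSeries ℚ ℂ) (ν : ℚ) (φ : Polynomial ℂ) : Prop where
  lead : ∀ z, HasLead (x z) ν (φ.eval z)
  lead_derivative : ∀ z, HasLead (x' z) (ν - B.height) (φ.derivative.eval z)

open Polynomial in
-- Each arc over the bar contributes a factor `z - c` at order `h(B)`; any other arc contributes a
-- nonzero constant at an order below `h(B)`. Since `z` enters through `z y ^ h(B)`, differentiating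
-- in `x` differentiates the form and lowers the order by `h(B)`.
theorem IsAdmissible.exists_hasBarForm_rootsPoly (hB : IsAdmissible B)
    (S : Multiset (HahnSeries ℚ ℂ)) : ∃ (κ : ℚ) (k : ℂ), k ≠ 0 ∧
      HasBarForm B (fun z => (rootsPoly S).eval (barArc B z))
        (fun z => (rootsPoly S).derivative.eval (barArc B z)) κ
        (C k * rootsPoly (overCoeffs B S)) := by
  classical
  induction S using Multiset.induction_on with
  | empty =>
    refine ⟨0, 1, one_ne_zero, ⟨fun z => ?_, fun z => ?_⟩⟩
    · simpa [rootsPoly, overCoeffs] using hasLead_one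
    · simpa [rootsPoly, overCoeffs] using hasLead_zero _
  | cons γ S ih =>
    obtain ⟨κ, k, hk, h1, h2⟩ := ih
    have hcons : rootsPoly (γ ::ₘ S) = (X - C γ) * rootsPoly S := by simp [rootsPoly]
    have hev : ∀ z, (rootsPoly (γ ::ₘ S)).eval (barArc B z) =
        (barArc B z - γ) * (rootsPoly S).eval (barArc B z) := by
      intro z; rw [hcons]; simp
    have hder : ∀ z, (rootsPoly (γ ::ₘ S)).derivative.eval (barArc B z) =
        (rootsPoly S).eval (barArc B z) +
          (barArc B z - γ) * (rootsPoly S).derivative.eval (barArc B z) := by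
      intro z; rw [hcons, derivative_mul]; simp
    by_cases h : IsOver B γ
    · have hA : overCoeffs B (γ ::ₘ S) = γ.coeff B.height ::ₘ overCoeffs B S := by
        simp [overCoeffs, Multiset.filter_cons_of_pos _ h]
      have hA' : C k * rootsPoly (overCoeffs B (γ ::ₘ S)) =
          (X - C (γ.coeff B.height)) * (C k * rootsPoly (overCoeffs B S)) := by
        rw [hA]; simp [rootsPoly]; ring
      refine ⟨B.height + κ, k, hk, ⟨fun z => ?_, fun z => ?_⟩⟩
      · rw [hA', hev]
        simpa using (hB.hasLead_sub_of_isOver h z).mul (h1 z)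
      · rw [hA', hder, derivative_mul]
        have e1 := h1 z
        have e2 := (hB.hasLead_sub_of_isOver h z).mul (h2 z)
        rw [add_sub_cancel] at e2
        rw [add_sub_cancel_left]
        simpa using e1.add e2
    · obtain ⟨μ, hμ, c, hc, hlead⟩ := exists_hasLead_sub_of_not_isOver h
      have hA : overCoeffs B (γ ::ₘ S) = overCoeffs B S := by
        simp [overCoeffs, Multiset.filter_cons_of_neg _ h]
      have hA' : C (c * k) * rootsPoly (overCoeffs B (γ ::ₘ S)) =
          C c * (C k * rootsPoly (overCoeffs B S)) := by
        rw [hA, C_mul]; ring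
      refine ⟨μ + κ, c * k, mul_ne_zero hc hk, ⟨fun z => ?_, fun z => ?_⟩⟩
      · rw [hA', hev]
        simpa using (hlead z).mul (h1 z)
      · rw [hA', hder, derivative_C_mul]
        -- As the arc separates below the height, this summand of the product rule lies above the
        -- expected order and contributes zero.
        have e1 := (h1 z).of_lt (μ := μ + (κ - B.height)) (by linarith)
        have e2 := (hlead z).mul (h2 z)
        rw [show μ + κ - B.height = μ + (κ - B.height) by ring]
        simpa using e1.add e2

open Polynomial in
theorem IsAdmissible.exists_hasBarForm (hB : IsAdmissible B) {F : Series2} {e : ℕ} {U : Series2}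
    {S : Multiset (HahnSeries ℚ ℂ)} (hF : IsPuiseuxFactorization F e U S) :
    ∃ (ν : ℚ) (k : ℂ), k ≠ 0 ∧
      HasBarForm B (fun z => evalArc F (barArc B z))
        (fun z => evalArc (MvPowerSeries.pderiv ℂ 0 F) (barArc B z)) ν
        (C k * rootsPoly (overCoeffs B S)) := by
  obtain ⟨κ, k, hk, h1, h2⟩ := hB.exists_hasBarForm_rootsPoly S
  set u := MvPowerSeries.constantCoeff U with hu
  have hCu : C (u * k) * rootsPoly (overCoeffs B S) =
      C u * (C k * rootsPoly (overCoeffs B S)) := by rw [C_mul]; ring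
  refine ⟨e + κ, u * k, mul_ne_zero hF.unit hk, ⟨fun z => ?_, fun z => ?_⟩⟩
  · have hpos := hB.orderTop_barArc_pos z
    rw [hF.eval_eq _ hpos, hCu]
    have := ((hasLead_yArc_pow e).mul (hasLead_evalArc hpos U)).mul (h1 z)
    simpa using this
  · have hpos := hB.orderTop_barArc_pos z
    rw [hF.eval_pderiv _ hpos, hCu, derivative_C_mul]
    -- Positivity of the height puts the term with the derivative of `U` above the expected order.
    have e1 := ((hasLead_evalArc hpos (MvPowerSeries.pderiv ℂ 0 U)).mul (h1 z)).of_lt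
      (μ := κ - B.height) (by linarith [hB.height_pos])
    have e2 := (hasLead_evalArc hpos U).mul (h2 z)
    rw [zero_add] at e2
    have := (hasLead_yArc_pow e).mul (e1.add e2)
    rw [add_sub_assoc]
    simpa using this

open Polynomial in
theorem C_mul_rootsPoly_ne_zero {k : ℂ} (hk : k ≠ 0) (A : Multiset ℂ) :
    C k * rootsPoly A ≠ 0 :=
  mul_ne_zero (C_ne_zero.mpr hk) (rootsPoly_monic A).ne_zero

theorem eventually_cofinite_eval_ne_zero {φ : Polynomial ℂ} (hφ : φ ≠ 0) :
    ∀ᶠ z in Filter.cofinite, φ.eval z ≠ 0 := by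
  have : {z | ¬ φ.eval z ≠ 0}.Finite := by
    simpa [Polynomial.IsRoot] using Polynomial.finite_setOfPred_isRoot hφ
  exact this

theorem HasBarForm.nu_eq {F : Series2} (hB : IsAdmissible B) {x' : ℂ → HahnSeries ℚ ℂ} {ν : ℚ}
    {φ : Polynomial ℂ} (h : HasBarForm B (fun z => evalArc F (barArc B z)) x' ν φ) (hφ : φ ≠ 0) :
    nu F B = ν := by
  refine TreeModel.nu_eq hB.height_pos.ne' ?_
  filter_upwards [eventually_cofinite_eval_ne_zero hφ] with z hz
  exact (h.lead z).orderTop_eq hz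

theorem HasBarForm.nu_pos {F : Series2} (hF0 : MvPowerSeries.constantCoeff F = 0)
    (hB : IsAdmissible B) {x' : ℂ → HahnSeries ℚ ℂ} {ν : ℚ}
    {φ : Polynomial ℂ} (h : HasBarForm B (fun z => evalArc F (barArc B z)) x' ν φ) (hφ : φ ≠ 0) :
    0 < ν := by
  obtain ⟨z, hz⟩ := (eventually_cofinite_eval_ne_zero hφ).exists
  have := lt_orderTop_evalArc (hB.orderTop_barArc_pos z) hF0
  rw [(h.lead z).orderTop_eq hz] at this
  exact_mod_cast this

open Polynomial in
/-- The leading form of the Jacobian along a bar. -/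
theorem HasBarForm.jacobian_eq {f g : Series2} (hB : IsAdmissible B) {νf νg : ℚ}
    {φf φg : Polynomial ℂ}
    (hf : HasBarForm B (fun z => evalArc f (barArc B z))
      (fun z => evalArc (MvPowerSeries.pderiv ℂ 0 f) (barArc B z)) νf φf)
    (hg : HasBarForm B (fun z => evalArc g (barArc B z))
      (fun z => evalArc (MvPowerSeries.pderiv ℂ 0 g) (barArc B z)) νg φg) (z : ℂ) :
    HasLead (yArc * evalArc (jacobian f g) (barArc B z)) (νf + νg - B.height)
      ((C (νf : ℂ) * φf * derivative φg - C (νg : ℂ) * derivative φf * φg).eval z) := by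
  rw [yArc_mul_evalArc_jacobian (hB.orderTop_barArc_pos z)]
  have h1 := (hf.lead z).euler.mul (hg.lead_derivative z)
  have h2 := (hf.lead_derivative z).mul (hg.lead z).euler
  rw [show νf + (νg - B.height) = νf + νg - B.height by ring] at h1
  rw [show νf - B.height + νg = νf + νg - B.height by ring] at h2
  have h3 := h1.sub h2
  convert h3 using 1
  simp
  ring

open Polynomial in
/-- If the leading form of the Jacobian along a bar does not vanish, then its zeros are the points
at which the roots of the Jacobian climb over the bar. -/
theorem HasBarForm.count_jacobian {f g : Series2} (hB : IsAdmissible B) {νf νg : ℚ}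
    {φf φg ψ : Polynomial ℂ}
    (hf : HasBarForm B (fun z => evalArc f (barArc B z))
      (fun z => evalArc (MvPowerSeries.pderiv ℂ 0 f) (barArc B z)) νf φf)
    (hg : HasBarForm B (fun z => evalArc g (barArc B z))
      (fun z => evalArc (MvPowerSeries.pderiv ℂ 0 g) (barArc B z)) νg φg)
    (hψ : ψ = C (νf : ℂ) * φf * derivative φg - C (νg : ℂ) * derivative φf * φg) (hψ0 : ψ ≠ 0) :
    jacobian f g ≠ 0 ∧ ∀ (e : ℕ) (U : Series2) (S : Multiset (HahnSeries ℚ ℂ)),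
      IsPuiseuxFactorization (jacobian f g) e U S → ∀ a : ℂ,
        ψ.rootMultiplicity a = (overCoeffs B S).count a := by
  classical
  have hlead := hf.jacobian_eq hB hg
  rw [← hψ] at hlead
  constructor
  · intro h0
    refine hψ0 (Polynomial.funext fun z => ?_)
    have := (hlead z).2
    rw [h0, evalArc_zero, mul_zero] at this
    rw [← this]; simp
  · intro e U S hS a
    obtain ⟨ν, k, hk, hJ⟩ := hB.exists_hasBarForm hS
    set φ := C k * rootsPoly (overCoeffs B S) with hφ
    have hφ0 : φ ≠ 0 := C_mul_rootsPoly_ne_zero hk _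
    have hJ' : ∀ z, HasLead (yArc * evalArc (jacobian f g) (barArc B z)) (1 + ν) (φ.eval z) := by
      intro z
      have := (hasLead_yArc_pow 1).mul (hJ.lead z)
      simpa using this
    -- `y J` has two leading forms, one from `f` and `g` and one from the factorization of `J`. At a
    -- `z` where neither vanishes their orders must agree, and then the forms agree everywhere.
    obtain ⟨z, hz1, hz2⟩ := ((eventually_cofinite_eval_ne_zero hψ0).and
      (eventually_cofinite_eval_ne_zero hφ0)).exists
    have hν : 1 + ν = νf + νg - B.height :=
      le_antisymm ((hlead z).le_of_ne (hJ' z) hz1) ((hJ' z).le_of_ne (hlead z) hz2)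
    have heq : ψ = φ := by
      refine Polynomial.funext fun w => ?_
      have h1 := (hJ' w).2
      rw [hν] at h1
      rw [← h1, (hlead w).2]
    rw [heq, hφ, ← count_roots, roots_C_mul _ hk, rootsPoly,
      roots_multiset_prod_X_sub_C]

end BarForm

end TreeModel

end

noncomputable section

namespace TreeModel

/-! ### Zeros and poles of sums of simple fractions -/

section PartialFractions

open Polynomial

/-- The rational function with simple poles and given residues. -/
def polarSum (T : Finset ℂ) (d : ℂ → ℂ) : RatFunc ℂ :=
  ∑ c ∈ T, RatFunc.C (d c) / (RatFunc.X - RatFunc.C c)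

theorem ratFunc_X_sub_C (c : ℂ) :
    RatFunc.X - RatFunc.C c = algebraMap ℂ[X] (RatFunc ℂ) (X - C c) := by
  rw [map_sub, RatFunc.algebraMap_X, RatFunc.algebraMap_C]

theorem ratFunc_X_sub_C_ne_zero (c : ℂ) : (RatFunc.X - RatFunc.C c : RatFunc ℂ) ≠ 0 := by
  rw [ratFunc_X_sub_C]
  exact RatFunc.algebraMap_ne_zero (X_sub_C_ne_zero c)

/-- Zeros and poles of the reduced fraction are read off by comparing it with the fraction over the
full product of denominators. -/
theorem polarSum_num_denom (T : Finset ℂ) (d : ℂ → ℂ) :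
    (polarSum T d).num * ∏ c ∈ T, (X - C c) =
      (∑ c ∈ T, C (d c) * ∏ c' ∈ T.erase c, (X - C c')) * (polarSum T d).denom := by
  have h1 : polarSum T d * algebraMap ℂ[X] (RatFunc ℂ) (∏ c ∈ T, (X - C c)) =
      algebraMap ℂ[X] (RatFunc ℂ) (∑ c ∈ T, C (d c) * ∏ c' ∈ T.erase c, (X - C c')) := by
    rw [polarSum, Finset.sum_mul, map_sum]
    refine Finset.sum_congr rfl fun c hc => ?_
    rw [← Finset.mul_prod_erase T _ hc, map_mul, map_mul, ratFunc_X_sub_C, RatFunc.algebraMap_C,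
      ← mul_assoc, div_mul_cancel₀]
    exact RatFunc.algebraMap_ne_zero (X_sub_C_ne_zero c)
  apply RatFunc.algebraMap_injective
  have hden : algebraMap ℂ[X] (RatFunc ℂ) (polarSum T d).denom ≠ 0 :=
    RatFunc.algebraMap_ne_zero (RatFunc.denom_ne_zero _)
  have h2 := RatFunc.num_div_denom (polarSum T d)
  rw [div_eq_iff hden] at h2
  rw [map_mul, map_mul, h2, ← h1]
  ring

theorem eval_sum_mul_prod_erase {T : Finset ℂ} {d : ℂ → ℂ} {c : ℂ} (hc : c ∈ T) (hd : d c ≠ 0) :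
    (∑ c ∈ T, C (d c) * ∏ c' ∈ T.erase c, (X - C c')).eval c ≠ 0 := by
  rw [eval_finsetSum, Finset.sum_eq_single c]
  · rw [eval_mul, eval_C, eval_prod]
    refine mul_ne_zero hd (Finset.prod_ne_zero_iff.mpr fun c' hc' => ?_)
    rw [eval_sub, eval_X, eval_C, sub_ne_zero]
    exact (Finset.ne_of_mem_erase hc').symm
  · intro b _ hbc
    rw [eval_mul, eval_prod, Finset.prod_eq_zero (Finset.mem_erase.mpr ⟨hbc.symm, hc⟩), mul_zero]
    simp
  · exact fun h => absurd hc h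

theorem polarSum_ne_zero {T : Finset ℂ} {d : ℂ → ℂ} (hd : ∀ c ∈ T, d c ≠ 0) {c : ℂ}
    (hc : c ∈ T) : polarSum T d ≠ 0 := by
  intro h
  have h1 := polarSum_num_denom T d
  rw [h, RatFunc.num_zero, zero_mul, RatFunc.denom_zero, mul_one] at h1
  refine eval_sum_mul_prod_erase hc (hd c hc) ?_
  rw [← h1, eval_zero]

theorem polarSum_filter (T : Finset ℂ) (d : ℂ → ℂ) [DecidablePred fun c => d c ≠ 0] :
    polarSum (T.filter fun c => d c ≠ 0) d = polarSum T d := by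
  refine Finset.sum_subset (Finset.filter_subset _ _) fun c hc hc' => ?_
  have : d c = 0 := by
    by_contra h
    exact hc' (Finset.mem_filter.mpr ⟨hc, h⟩)
  rw [this, map_zero, zero_div]

theorem polarSum_rootMultiplicity_denom_of_notMem {T : Finset ℂ} {d : ℂ → ℂ}
    {c : ℂ} (hc : c ∉ T) :
    (polarSum T d).denom.rootMultiplicity c = 0 := by
  apply rootMultiplicity_eq_zero
  intro h
  have hcop : IsCoprime (polarSum T d).denom (polarSum T d).num :=
    (RatFunc.isCoprime_num_denom _).symm
  have hdvd : (polarSum T d).denom ∣ ∏ c ∈ T, (X - C c) :=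
    hcop.dvd_of_dvd_mul_left (Dvd.intro_left _ (polarSum_num_denom T d).symm)
  have h0 : (∏ c ∈ T, (X - C c)).eval c = 0 := h.dvd hdvd
  rw [eval_prod, Finset.prod_eq_zero_iff] at h0
  obtain ⟨c', hc', h'⟩ := h0
  rw [eval_sub, eval_X, eval_C, sub_eq_zero] at h'
  exact hc (h' ▸ hc')

/-- The unreduced numerator does not vanish at `c` and the full product has a simple zero there.
Comparing multiplicities makes `c` a zero of the reduced denominator, and coprimality excludes it
from the numerator. -/
theorem polarSum_rootMultiplicity_of_mem {T : Finset ℂ} {d : ℂ → ℂ}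
    (hd : ∀ c ∈ T, d c ≠ 0) {c : ℂ} (hc : c ∈ T) :
    (polarSum T d).num.rootMultiplicity c = 0 ∧ (polarSum T d).denom.rootMultiplicity c = 1 := by
  have hnum : (polarSum T d).num ≠ 0 := RatFunc.num_ne_zero (polarSum_ne_zero hd hc)
  have hprod : (∏ c ∈ T, (X - C c) : ℂ[X]) ≠ 0 :=
    Finset.prod_ne_zero_iff.mpr fun c _ => X_sub_C_ne_zero c
  have hP := eval_sum_mul_prod_erase hc (hd c hc)
  have h1 := congrArg (rootMultiplicity c) (polarSum_num_denom T d)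
  have hP0 : (∑ c ∈ T, C (d c) * ∏ c' ∈ T.erase c, (X - C c')) ≠ 0 := by
    intro h
    rw [h, eval_zero] at hP
    exact hP rfl
  have hQ : (∏ c ∈ T, (X - C c) : ℂ[X]).rootMultiplicity c = 1 := by
    classical
    rw [← count_roots, roots_prod_X_sub_C]
    exact Multiset.count_eq_one_of_mem T.nodup hc
  rw [rootMultiplicity_mul (mul_ne_zero hnum hprod),
    rootMultiplicity_mul (mul_ne_zero hP0 (RatFunc.denom_ne_zero _)), hQ,
    rootMultiplicity_eq_zero hP, zero_add] at h1
  have hden : (polarSum T d).denom.IsRoot c := by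
    rw [← rootMultiplicity_pos (RatFunc.denom_ne_zero _)]
    omega
  have hn : (polarSum T d).num.rootMultiplicity c = 0 := by
    apply rootMultiplicity_eq_zero
    intro h
    obtain ⟨u, v, huv⟩ := RatFunc.isCoprime_num_denom (polarSum T d)
    have := congrArg (eval c) huv
    rw [eval_add, eval_mul, eval_mul, h, hden] at this
    simp at this
  exact ⟨hn, by omega⟩

open Classical in
theorem polarSum_rootMultiplicity_denom (T : Finset ℂ) (d : ℂ → ℂ) (c : ℂ) :
    (polarSum T d).denom.rootMultiplicity c = if c ∈ T ∧ d c ≠ 0 then 1 else 0 := by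
  rw [← polarSum_filter T d]
  split_ifs with h
  · exact (polarSum_rootMultiplicity_of_mem (by simp) (Finset.mem_filter.mpr h)).2
  · exact polarSum_rootMultiplicity_denom_of_notMem
      fun h' => h (Finset.mem_filter.mp h')

theorem polarSum_rootMultiplicity_num {T : Finset ℂ} {d : ℂ → ℂ} {c : ℂ} (hc : c ∈ T)
    (hd : d c ≠ 0) : (polarSum T d).num.rootMultiplicity c = 0 := by
  classical
  rw [← polarSum_filter T d]
  exact (polarSum_rootMultiplicity_of_mem (by simp) (Finset.mem_filter.mpr ⟨hc, hd⟩)).1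

theorem polarSum_ne_zero_of_mem {T : Finset ℂ} {d : ℂ → ℂ} {c : ℂ} (hc : c ∈ T)
    (hd : d c ≠ 0) : polarSum T d ≠ 0 := by
  classical
  rw [← polarSum_filter T d]
  exact polarSum_ne_zero (by simp) (Finset.mem_filter.mpr ⟨hc, hd⟩)

/-- The logarithmic derivative of a product of linear factors. -/
theorem algebraMap_derivative_rootsPoly (A : Multiset ℂ) :
    algebraMap ℂ[X] (RatFunc ℂ) (derivative (rootsPoly A)) =
      algebraMap ℂ[X] (RatFunc ℂ) (rootsPoly A) *
        (A.map fun c => (RatFunc.X - RatFunc.C c)⁻¹).sum := by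
  induction A using Multiset.induction_on with
  | empty => simp [rootsPoly]
  | cons a A ih =>
    have hcons : rootsPoly (a ::ₘ A) = (X - C a) * rootsPoly A := by simp [rootsPoly]
    have ha := ratFunc_X_sub_C_ne_zero a
    rw [hcons, derivative_mul, map_add, map_mul, map_mul, map_mul, ih, Multiset.map_cons,
      Multiset.sum_cons, ← ratFunc_X_sub_C, derivative_X_sub_C, map_one]
    field_simp

open Classical in
theorem algebraMap_derivative_rootsPoly_eq_polarSum {A : Multiset ℂ} {T : Finset ℂ}
    (hA : ∀ a ∈ A, a ∈ T) :
    algebraMap ℂ[X] (RatFunc ℂ) (derivative (rootsPoly A)) =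
      algebraMap ℂ[X] (RatFunc ℂ) (rootsPoly A) * polarSum T fun c => (A.count c : ℂ) := by
  rw [algebraMap_derivative_rootsPoly, polarSum, Finset.sum_multiset_map_count]
  congr 1
  rw [Finset.sum_subset (s₂ := T) (fun a ha => hA a (Multiset.mem_toFinset.mp ha))]
  · refine Finset.sum_congr rfl fun c _ => ?_
    rw [nsmul_eq_mul, map_natCast, div_eq_mul_inv]
  · intro c _ hc
    rw [Multiset.count_eq_zero_of_notMem (by simpa using hc), zero_smul]

theorem polarSum_linear (T : Finset ℂ) (d e : ℂ → ℂ) (a b : ℂ) :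
    polarSum T (fun c => a * d c - b * e c) =
      RatFunc.C a * polarSum T d - RatFunc.C b * polarSum T e := by
  rw [polarSum, polarSum, polarSum, Finset.mul_sum, Finset.mul_sum, ← Finset.sum_sub_distrib]
  refine Finset.sum_congr rfl fun c _ => ?_
  rw [map_sub, map_mul, map_mul]
  ring

open Classical in
/-- The leading form of the Jacobian in terms of the associated rational function. -/
theorem rootMultiplicity_leadingForm {Af Ag : Multiset ℂ} {T : Finset ℂ}
    (hf : ∀ a ∈ Af, a ∈ T) (hg : ∀ a ∈ Ag, a ∈ T) {kf kg νf νg : ℂ} (hkf : kf ≠ 0) (hkg : kg ≠ 0)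
    {d : ℂ → ℂ} (hd : ∀ c, d c = νf * (Ag.count c : ℂ) - νg * (Af.count c : ℂ))
    {ψ : ℂ[X]} (hψ : ψ = C νf * (C kf * rootsPoly Af) * derivative (C kg * rootsPoly Ag) -
      C νg * derivative (C kf * rootsPoly Af) * (C kg * rootsPoly Ag))
    (hne : ∃ c ∈ T, d c ≠ 0) :
    ψ ≠ 0 ∧ ∀ c, ψ.rootMultiplicity c + (if c ∈ T ∧ d c ≠ 0 then 1 else 0) =
      Af.count c + Ag.count c + (polarSum T d).num.rootMultiplicity c := by
  obtain ⟨c₀, hc₀, hd₀⟩ := hne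
  set M := polarSum T d with hM
  have hM0 : M ≠ 0 := polarSum_ne_zero_of_mem hc₀ hd₀
  set φ := C kf * rootsPoly Af * (C kg * rootsPoly Ag) with hφ
  have hφ0 : φ ≠ 0 :=
    mul_ne_zero (C_mul_rootsPoly_ne_zero hkf _) (C_mul_rootsPoly_ne_zero hkg _)
  -- Dividing by `φ` leaves `νf` times the logarithmic derivative for `Ag` minus `νg` times the one
  -- for `Af`; the residue at `c` is `d c`.
  have h1 : algebraMap ℂ[X] (RatFunc ℂ) ψ = algebraMap ℂ[X] (RatFunc ℂ) φ * M := by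
    have hM' : M = RatFunc.C νf * polarSum T (fun c => (Ag.count c : ℂ)) -
        RatFunc.C νg * polarSum T (fun c => (Af.count c : ℂ)) := by
      rw [← polarSum_linear, hM]
      congr 1
      exact funext hd
    rw [hM', hψ, hφ, derivative_C_mul, derivative_C_mul]
    simp only [map_sub, map_mul, RatFunc.algebraMap_C,
      algebraMap_derivative_rootsPoly_eq_polarSum hf,
      algebraMap_derivative_rootsPoly_eq_polarSum hg]
    ring
  have hden0 : algebraMap ℂ[X] (RatFunc ℂ) M.denom ≠ 0 :=
    RatFunc.algebraMap_ne_zero (RatFunc.denom_ne_zero _)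
  have h2 : ψ * M.denom = φ * M.num := by
    apply RatFunc.algebraMap_injective
    have := RatFunc.num_div_denom M
    rw [div_eq_iff hden0] at this
    rw [map_mul, map_mul, h1, this]
    ring
  have hnum : M.num ≠ 0 := RatFunc.num_ne_zero hM0
  have hψ0 : ψ ≠ 0 := by
    rintro rfl
    rw [zero_mul] at h2
    exact mul_ne_zero hφ0 hnum h2.symm
  refine ⟨hψ0, fun c => ?_⟩
  have h3 := congrArg (rootMultiplicity c) h2
  rw [rootMultiplicity_mul (mul_ne_zero hψ0 (RatFunc.denom_ne_zero _)),
    rootMultiplicity_mul (mul_ne_zero hφ0 hnum), hφ, rootMultiplicity_mul hφ0,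
    ← count_roots (C kf * _), ← count_roots (C kg * _), roots_C_mul _ hkf, roots_C_mul _ hkg,
    rootsPoly, rootsPoly, roots_multiset_prod_X_sub_C, roots_multiset_prod_X_sub_C, hM,
    polarSum_rootMultiplicity_denom] at h3
  exact h3

end PartialFractions

end TreeModel

end

noncomputable section

namespace TreeModel

/-! ### Roots of the germs and of the Jacobian -/

section Roots

theorem rootMult_zero (γ : HahnSeries ℚ ℂ) : rootMult 0 γ = 0 := by
  have : {n : ℕ | evalArc ((MvPowerSeries.pderiv ℂ 0)^[n] (0 : Series2)) γ ≠ 0} = ∅ := by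
    ext n
    simp [evalArc_zero]
  rw [rootMult, this, Nat.sInf_empty]

/-- For the zero series `rootMult` is the infimum of the empty set, which is `0`, so the root `γ =
0` would not be simple. -/
theorem HasSimpleRoots.ne_zero {F : Series2} (hF : HasSimpleRoots F) : F ≠ 0 := by
  rintro rfl
  have h := hF 0 ⟨⟨by simp, 1, one_pos, by simp⟩, evalArc_zero 0⟩
  rw [rootMult_zero] at h
  exact zero_ne_one h

variable {F : Series2} {e : ℕ} {U : Series2} {S : Multiset (HahnSeries ℚ ℂ)}

theorem rootMultiplicity_rootsPoly {K : Type*} [Field K] [DecidableEq K] (S : Multiset K) (a : K) :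
    (rootsPoly S).rootMultiplicity a = S.count a := by
  rw [← Polynomial.count_roots, rootsPoly, Polynomial.roots_multiset_prod_X_sub_C]

theorem IsPuiseuxFactorization.mem_roots_iff (hF : IsPuiseuxFactorization F e U S)
    {γ : HahnSeries ℚ ℂ} : γ ∈ roots F ↔ γ ∈ S := by
  classical
  have key : IsArc γ → (evalArc F γ = 0 ↔ γ ∈ S) := by
    intro hγ
    have hy : yArc ^ e * evalArc U γ ≠ 0 := mul_ne_zero (pow_ne_zero _ yArc_ne_zero)
      (evalArc_ne_zero_of_constantCoeff hγ.1 hF.unit)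
    rw [hF.eval_eq γ hγ.1, mul_eq_zero, or_iff_right hy, ← Multiset.count_pos,
      ← rootMultiplicity_rootsPoly, Polynomial.rootMultiplicity_pos (rootsPoly_monic S).ne_zero]
    rfl
  exact ⟨fun h => (key h.1).mp h.2, fun h => ⟨hF.isArc γ h, (key (hF.isArc γ h)).mpr h⟩⟩

open Classical in
theorem IsPuiseuxFactorization.rootMult_eq_count (hF : IsPuiseuxFactorization F e U S)
    {γ : HahnSeries ℚ ℂ} (hγ : γ ∈ S) : rootMult F γ = S.count γ := by
  rw [hF.rootMult_eq γ (hF.isArc γ hγ).1, rootMultiplicity_rootsPoly]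

theorem roots_mul (f g : Series2) : roots (f * g) = roots f ∪ roots g := by
  ext γ
  constructor
  · rintro ⟨h, h'⟩
    rw [evalArc_mul h.1, mul_eq_zero] at h'
    exact h'.imp (fun h' => ⟨h, h'⟩) fun h' => ⟨h, h'⟩
  · rintro (⟨h, h'⟩ | ⟨h, h'⟩)
    · exact ⟨h, by rw [evalArc_mul h.1, h', zero_mul]⟩
    · exact ⟨h, by rw [evalArc_mul h.1, h', mul_zero]⟩

/-- Along a root of `f`, the `x`-derivative of `f * g` reduces to `g * f_x`, and simplicity makes it
nonzero. -/
theorem HasSimpleRoots.evalArc_ne_zero {f g : Series2} (h : HasSimpleRoots (f * g))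
    {γ : HahnSeries ℚ ℂ} (hγ : γ ∈ roots f) :
    evalArc g γ ≠ 0 ∧ evalArc (MvPowerSeries.pderiv ℂ 0 f) γ ≠ 0 := by
  have h1 := h γ (by rw [roots_mul]; exact Or.inl hγ)
  have h2 : 0 < rootMult (f * g) γ := by omega
  have h3 : evalArc ((MvPowerSeries.pderiv ℂ 0)^[rootMult (f * g) γ] (f * g)) γ ≠ 0 :=
    Nat.sInf_mem (Nat.nonempty_of_pos_sInf h2)
  rw [h1, Function.iterate_one, Derivation.leibniz, smul_eq_mul, smul_eq_mul, evalArc_add, evalArc_mul hγ.1.1,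
    evalArc_mul hγ.1.1, hγ.2, zero_mul, zero_add] at h3
  exact mul_ne_zero_iff.mp h3

theorem HasSimpleRoots.nodup {f g : Series2} (h : HasSimpleRoots (f * g))
    (hf : IsPuiseuxFactorization f e U S) : S.Nodup := by
  classical
  rw [Multiset.nodup_iff_count_le_one]
  intro γ
  by_cases hγ : γ ∈ S
  · rw [← hf.rootMult_eq_count hγ]
    exact Nat.sInf_le (h.evalArc_ne_zero (hf.mem_roots_iff.mpr hγ)).2
  · rw [Multiset.count_eq_zero_of_notMem hγ]
    exact zero_le_one

/-- Along a root of `f` only `-f_x` times the Euler derivative of `g` survives in `y J`. That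
derivative is nonzero because `g` is nonzero of positive order along the arc. -/
theorem evalArc_jacobian_ne_zero {f g : Series2} (h : HasSimpleRoots (f * g))
    (hg0 : MvPowerSeries.constantCoeff g = 0) {γ : HahnSeries ℚ ℂ} (hγ : γ ∈ roots f) :
    evalArc (jacobian f g) γ ≠ 0 := by
  have h1 := yArc_mul_evalArc_jacobian hγ.1.1 f g
  have h2 := h.evalArc_ne_zero hγ
  have h0 : euler 0 = 0 := by ext e; simp
  rw [hγ.2, h0, zero_mul, zero_sub] at h1
  intro h3
  rw [h3, mul_zero] at h1
  exact neg_ne_zero.mpr (mul_ne_zero h2.2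
    (euler_ne_zero h2.1 (lt_orderTop_evalArc hγ.1.1 hg0))) h1.symm

theorem jacobian_swap (f g : Series2) : jacobian g f = -jacobian f g := by
  rw [jacobian, jacobian]; ring

theorem polarRoots_eq {f g : Series2} (h : HasSimpleRoots (f * g))
    (hf0 : MvPowerSeries.constantCoeff f = 0) (hg0 : MvPowerSeries.constantCoeff g = 0) :
    polarRoots f g = roots (jacobian f g) := by
  ext γ
  refine ⟨fun hγ => hγ.1, fun hγ => ⟨hγ, fun hγ' => ?_⟩⟩
  rw [roots_mul] at hγ'
  rcases hγ' with hγ' | hγ'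
  · exact evalArc_jacobian_ne_zero h hg0 hγ' hγ.2
  · rw [mul_comm] at h
    refine evalArc_jacobian_ne_zero h hf0 hγ' ?_
    rw [jacobian_swap, ← evalHom_apply hγ.1.1, map_neg, evalHom_apply, hγ.2, neg_zero]

end Roots

/-! ### Counting roots at the points of a bar -/

section Counting

open Classical in
theorem count_overCoeffs (B : Bar) (S : Multiset (HahnSeries ℚ ℂ)) (c : ℂ) :
    (overCoeffs B S).count c = (S.filter fun γ => ClimbsAt γ B c).card := by
  rw [overCoeffs, Multiset.count_map, Multiset.filter_filter]
  congr 1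
  refine Multiset.filter_congr fun γ _ => ?_
  rw [climbsAt_iff, and_comm, eq_comm (a := c)]

open Classical in
theorem overCoeffs_add (B : Bar) (S S' : Multiset (HahnSeries ℚ ℂ)) :
    overCoeffs B (S + S') = overCoeffs B S + overCoeffs B S' := by
  simp [overCoeffs]

theorem mem_overCoeffs {B : Bar} {S : Multiset (HahnSeries ℚ ℂ)} {c : ℂ} :
    c ∈ overCoeffs B S ↔ ∃ γ ∈ S, ClimbsAt γ B c := by
  classical
  simp only [overCoeffs, Multiset.mem_map, Multiset.mem_filter, climbsAt_iff, and_assoc]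

open Classical in
theorem ncard_trunk {F : Series2} {S : Multiset (HahnSeries ℚ ℂ)}
    (hS : ∀ γ, γ ∈ roots F ↔ γ ∈ S) (hnd : S.Nodup) (B : Bar) (c : ℂ) :
    (trunk F B c).ncard = (overCoeffs B S).count c := by
  have : trunk F B c = ((S.filter fun γ => ClimbsAt γ B c).toFinset : Set (HahnSeries ℚ ℂ)) := by
    ext γ
    simp [trunk, hS]
  rw [this, Set.ncard_coe_finset, count_overCoeffs,
    Multiset.toFinset_card_of_nodup (hnd.filter _)]

end Counting

/-! ### The local count of the roots of the Jacobian -/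

section TreeRoots

/-- The multisets of roots of the two germs of a tree model. -/
structure IsTreeRoots (f g : Series2) (Sf Sg : Multiset (HahnSeries ℚ ℂ)) : Prop where
  factor_left : ∃ e U, IsPuiseuxFactorization f e U Sf
  factor_right : ∃ e U, IsPuiseuxFactorization g e U Sg
  constantCoeff_left : MvPowerSeries.constantCoeff f = 0
  constantCoeff_right : MvPowerSeries.constantCoeff g = 0
  simple : HasSimpleRoots (f * g)

theorem exists_isTreeRoots {f g : Series2} (hf0 : MvPowerSeries.constantCoeff f = 0)
    (hg0 : MvPowerSeries.constantCoeff g = 0) (h : HasSimpleRoots (f * g)) :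
    ∃ Sf Sg, IsTreeRoots f g Sf Sg := by
  have hne := h.ne_zero
  obtain ⟨e, U, S, hS⟩ := exists_isPuiseuxFactorization (left_ne_zero_of_mul hne)
  obtain ⟨e', U', S', hS'⟩ := exists_isPuiseuxFactorization (right_ne_zero_of_mul hne)
  exact ⟨S, S', ⟨e, U, hS⟩, ⟨e', U', hS'⟩, hf0, hg0, h⟩

namespace IsTreeRoots

variable {f g : Series2} {Sf Sg : Multiset (HahnSeries ℚ ℂ)} {B : Bar}

theorem mem_left (h : IsTreeRoots f g Sf Sg) (γ : HahnSeries ℚ ℂ) : γ ∈ roots f ↔ γ ∈ Sf := by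
  obtain ⟨e, U, hS⟩ := h.factor_left
  exact hS.mem_roots_iff

theorem mem_right (h : IsTreeRoots f g Sf Sg) (γ : HahnSeries ℚ ℂ) : γ ∈ roots g ↔ γ ∈ Sg := by
  obtain ⟨e, U, hS⟩ := h.factor_right
  exact hS.mem_roots_iff

theorem mem_mul (h : IsTreeRoots f g Sf Sg) (γ : HahnSeries ℚ ℂ) :
    γ ∈ roots (f * g) ↔ γ ∈ Sf + Sg := by
  rw [roots_mul, Set.mem_union, h.mem_left, h.mem_right, Multiset.mem_add]

theorem nodup_left (h : IsTreeRoots f g Sf Sg) : Sf.Nodup := by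
  obtain ⟨e, U, hS⟩ := h.factor_left
  exact h.simple.nodup hS

theorem nodup_right (h : IsTreeRoots f g Sf Sg) : Sg.Nodup := by
  obtain ⟨e, U, hS⟩ := h.factor_right
  have := h.simple
  rw [mul_comm] at this
  exact this.nodup hS

theorem nodup (h : IsTreeRoots f g Sf Sg) : (Sf + Sg).Nodup := by
  rw [Multiset.nodup_add]
  refine ⟨h.nodup_left, h.nodup_right, Multiset.disjoint_left.mpr fun {γ} hf hg => ?_⟩
  exact (h.simple.evalArc_ne_zero ((h.mem_left γ).mpr hf)).1 ((h.mem_right γ).mpr hg).2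

theorem finite_roots (h : IsTreeRoots f g Sf Sg) : (roots (f * g)).Finite := by
  classical
  refine (Sf + Sg).toFinset.finite_toSet.subset fun γ hγ => ?_
  simpa using (h.mem_mul γ).mp hγ

open Classical in
theorem trunkPoints_eq (h : IsTreeRoots f g Sf Sg) (B : Bar) :
    trunkPoints f g B = ((overCoeffs B (Sf + Sg)).toFinset : Set ℂ) := by
  ext c
  rw [Finset.mem_coe, Multiset.mem_toFinset, mem_overCoeffs]
  exact exists_congr fun γ => and_congr_left' (h.mem_mul γ)

theorem finite_trunkPoints (h : IsTreeRoots f g Sf Sg) (B : Bar) : (trunkPoints f g B).Finite := by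
  classical
  rw [h.trunkPoints_eq]
  exact Finset.finite_toSet _

open Classical in
theorem meroFunction_eq (h : IsTreeRoots f g Sf Sg) (B : Bar) :
    meroFunction f g B =
      polarSum (overCoeffs B (Sf + Sg)).toFinset fun c => ((delta f g B c : ℚ) : ℂ) := by
  rw [meroFunction, h.trunkPoints_eq, finsum_mem_coe_finset, polarSum]

open Classical in
theorem delta_eq (h : IsTreeRoots f g Sf Sg) (B : Bar) (c : ℂ) :
    delta f g B c = nu f B * ((overCoeffs B Sg).count c : ℚ) -
      nu g B * ((overCoeffs B Sf).count c : ℚ) := by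
  rw [delta, ncard_trunk h.mem_left h.nodup_left, ncard_trunk h.mem_right h.nodup_right]

open Classical in
theorem mem_nonCollinearPoints (h : IsTreeRoots f g Sf Sg) {c : ℂ} :
    c ∈ nonCollinearPoints f g B ↔
      c ∈ (overCoeffs B (Sf + Sg)).toFinset ∧ ((delta f g B c : ℚ) : ℂ) ≠ 0 := by
  rw [← Finset.mem_coe, ← h.trunkPoints_eq, Rat.cast_ne_zero]
  rfl

open Classical in
theorem meroFunction_ne_zero (h : IsTreeRoots f g Sf Sg) (hN : IsNonCollinear f g B) :
    meroFunction f g B ≠ 0 := by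
  obtain ⟨c, hc⟩ := hN
  rw [h.mem_nonCollinearPoints] at hc
  rw [h.meroFunction_eq]
  exact polarSum_ne_zero_of_mem hc.1 hc.2

theorem meroMult_eq_zero (h : IsTreeRoots f g Sf Sg) {c : ℂ}
    (hc : c ∈ nonCollinearPoints f g B) : meroMult f g B c = 0 := by
  classical
  rw [h.mem_nonCollinearPoints] at hc
  rw [meroMult, h.meroFunction_eq]
  exact polarSum_rootMultiplicity_num hc.1 hc.2

theorem mem_meroZeros_iff (h : IsTreeRoots f g Sf Sg) (hN : IsNonCollinear f g B) {c : ℂ} :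
    c ∈ meroZeros f g B ↔ meroMult f g B c ≠ 0 := by
  rw [← pos_iff_ne_zero, meroMult,
    Polynomial.rootMultiplicity_pos (RatFunc.num_ne_zero (h.meroFunction_ne_zero hN))]
  rfl

theorem finite_meroZeros (h : IsTreeRoots f g Sf Sg) (hN : IsNonCollinear f g B) :
    (meroZeros f g B).Finite :=
  Polynomial.finite_setOfPred_isRoot (RatFunc.num_ne_zero (h.meroFunction_ne_zero hN))

theorem meroZeros_eq_univ (hN : ¬ IsNonCollinear f g B) : meroZeros f g B = Set.univ := by
  have hz : meroFunction f g B = 0 := by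
    refine finsum_mem_eq_zero_of_forall_eq_zero fun c hc => ?_
    have : delta f g B c = 0 := by
      by_contra h'
      exact hN ⟨c, hc, h'⟩
    rw [this]; simp
  ext z
  simp [meroZeros, hz]

open Classical in
/-- The number of roots of the Jacobian that climb over a bar at a point. -/
theorem count_jacobian (h : IsTreeRoots f g Sf Sg) (hB : IsAdmissible B)
    (hN : IsNonCollinear f g B) :
    jacobian f g ≠ 0 ∧ ∀ (e : ℕ) (U : Series2) (S : Multiset (HahnSeries ℚ ℂ)),
      IsPuiseuxFactorization (jacobian f g) e U S → ∀ a : ℂ,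
        (overCoeffs B S).count a + (if a ∈ nonCollinearPoints f g B then 1 else 0) =
          (overCoeffs B (Sf + Sg)).count a + meroMult f g B a := by
  obtain ⟨ef, Uf, hf⟩ := h.factor_left
  obtain ⟨eg, Ug, hg⟩ := h.factor_right
  obtain ⟨νf, kf, hkf, hφf⟩ := hB.exists_hasBarForm hf
  obtain ⟨νg, kg, hkg, hφg⟩ := hB.exists_hasBarForm hg
  have hνf := hφf.nu_eq hB (C_mul_rootsPoly_ne_zero hkf _)
  have hνg := hφg.nu_eq hB (C_mul_rootsPoly_ne_zero hkg _)
  have hmem : ∀ a, a ∈ (overCoeffs B (Sf + Sg)).toFinset ↔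
      a ∈ overCoeffs B Sf ∨ a ∈ overCoeffs B Sg := by
    intro a
    rw [Multiset.mem_toFinset, overCoeffs_add, Multiset.mem_add]
  have key := rootMultiplicity_leadingForm (Af := overCoeffs B Sf) (Ag := overCoeffs B Sg)
    (T := (overCoeffs B (Sf + Sg)).toFinset) (fun a ha => (hmem a).mpr (Or.inl ha))
    (fun a ha => (hmem a).mpr (Or.inr ha)) (νf := νf) (νg := νg) hkf hkg
    (d := fun c => ((delta f g B c : ℚ) : ℂ)) (fun c => by
      rw [h.delta_eq, hνf, hνg]; push_cast; rfl) rfl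
    (by
      obtain ⟨c, hc⟩ := hN
      exact ⟨c, h.mem_nonCollinearPoints.mp hc⟩)
  have hJ := HasBarForm.count_jacobian hB hφf hφg rfl key.1
  refine ⟨hJ.1, fun e U S hS a => ?_⟩
  rw [← hJ.2 e U S hS a, overCoeffs_add, Multiset.count_add, meroMult, h.meroFunction_eq]
  have := key.2 a
  simp only [h.mem_nonCollinearPoints]
  exact this

open Classical in
/-- Both germs have roots in the trunks that grow at collinear points. -/
theorem two_le_count_of_collinear (h : IsTreeRoots f g Sf Sg) (hB : IsAdmissible B) {c : ℂ}
    (hc : c ∈ collinearPoints f g B) : 2 ≤ (overCoeffs B (Sf + Sg)).count c := by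
  obtain ⟨ef, Uf, hf⟩ := h.factor_left
  obtain ⟨eg, Ug, hg⟩ := h.factor_right
  obtain ⟨νf, kf, hkf, hφf⟩ := hB.exists_hasBarForm hf
  obtain ⟨νg, kg, hkg, hφg⟩ := hB.exists_hasBarForm hg
  have hνf := hφf.nu_eq hB (C_mul_rootsPoly_ne_zero hkf _)
  have hνg := hφg.nu_eq hB (C_mul_rootsPoly_ne_zero hkg _)
  have hf0 := hφf.nu_pos h.constantCoeff_left hB (C_mul_rootsPoly_ne_zero hkf _)
  have hg0 := hφg.nu_pos h.constantCoeff_right hB (C_mul_rootsPoly_ne_zero hkg _)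
  obtain ⟨hT, hd⟩ := hc
  rw [h.trunkPoints_eq, Finset.mem_coe, Multiset.mem_toFinset, ← Multiset.count_pos,
    overCoeffs_add, Multiset.count_add] at hT
  rw [h.delta_eq, hνf, hνg, sub_eq_zero] at hd
  rw [overCoeffs_add, Multiset.count_add]
  -- With fewer than two roots, one of the two germs has none in the trunk. As both orders are
  -- positive, `Δ = 0` then excludes roots of the other germ too.
  by_contra! hlt
  rcases Nat.eq_zero_or_pos ((overCoeffs B Sf).count c) with h0 | h0
  · rw [h0, Nat.cast_zero, mul_zero, mul_eq_zero] at hd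
    have := Nat.cast_eq_zero.mp (hd.resolve_left hf0.ne')
    omega
  · have h0' : (overCoeffs B Sg).count c = 0 := by omega
    rw [h0', Nat.cast_zero, mul_zero, eq_comm, mul_eq_zero] at hd
    have := Nat.cast_eq_zero.mp (hd.resolve_left hg0.ne')
    omega

end IsTreeRoots

end TreeRoots

end TreeModel

end

noncomputable section

namespace TreeModel

/-! ### Postbars -/

section Postbars

variable {f g : Series2} {B B' B'' : Bar} {c : ℂ}

theorem coeff_eq_of_le_contactOrder {γ γ' : HahnSeries ℚ ℂ} {h : ℚ}
    (hc : (h : WithTop ℚ) ≤ contactOrder γ γ') {e : ℚ} (he : e < h) : γ.coeff e = γ'.coeff e := by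
  have : (γ - γ').coeff e = 0 := HahnSeries.coeff_eq_zero_of_lt_orderTop
    (lt_of_lt_of_le (by exact_mod_cast he) hc)
  rwa [HahnSeries.coeff_sub, sub_eq_zero] at this

theorem ClimbsAt.unique {γ : HahnSeries ℚ ℂ} {a b : ℂ} (ha : ClimbsAt γ B a)
    (hb : ClimbsAt γ B b) : a = b := ha.2.symm.trans hb.2

theorem IsOver.climbsAt {γ : HahnSeries ℚ ℂ} (h : IsOver B γ) : ClimbsAt γ B (γ.coeff B.height) :=
  ⟨h, rfl⟩

theorem IsPostbar.height_lt (h : IsPostbar f g B c B') : B.height < B'.height := by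
  obtain ⟨⟨⟨γ, hγ, γ', hγ', hc⟩, -⟩, -⟩ := h
  have : (B.height : WithTop ℚ) < contactOrder γ γ' := by
    refine lt_orderTop_iff.mpr fun e he => ?_
    rw [HahnSeries.coeff_sub, sub_eq_zero]
    rcases he.lt_or_eq with he | rfl
    · rw [hγ.2.1 e he, hγ'.2.1 e he]
    · rw [hγ.2.2, hγ'.2.2]
  rw [← hc] at this
  exact_mod_cast this

theorem IsPostbar.coeff_center (h : IsPostbar f g B c B') {γ : HahnSeries ℚ ℂ}
    (hγ : γ ∈ trunk (f * g) B c) {e : ℚ} (he : e < B'.height) :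
    γ.coeff e = B'.center.coeff e := by
  obtain ⟨⟨-, hmin⟩, γ₀, hγ₀, hcen⟩ := h
  rw [hcen, HahnSeries.coeff_truncLT_of_lt he]
  exact coeff_eq_of_le_contactOrder (hmin ⟨γ, hγ, γ₀, hγ₀, rfl⟩) he

theorem IsPostbar.isOver (h : IsPostbar f g B c B') {γ : HahnSeries ℚ ℂ}
    (hγ : γ ∈ trunk (f * g) B c) : IsOver B' γ := fun _ he => h.coeff_center hγ he

/-- Roots in the trunk agree with `λ_{B'}` up to `h(B') > h(B)`, so an arc over `B'` inherits their
coefficient `c` at `h(B)`. -/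
theorem IsPostbar.climbsAt (h : IsPostbar f g B c B') {ξ : HahnSeries ℚ ℂ} (hξ : IsOver B' ξ) :
    ClimbsAt ξ B c := by
  have hlt := h.height_lt
  obtain ⟨γ, hγ, -⟩ := h.1.1
  refine ⟨fun e he => ?_, ?_⟩
  · rw [hξ e (he.trans hlt), ← h.coeff_center hγ (he.trans hlt), hγ.2.1 e he]
  · rw [hξ _ hlt, ← h.coeff_center hγ hlt, hγ.2.2]

/-- Admissible bars with at least two points at which trunks grow. -/
structure IsGood (f g : Series2) (B : Bar) : Prop extends IsAdmissible B where
  split : ∃ γ ∈ roots (f * g), ∃ γ' ∈ roots (f * g), IsOver B γ ∧ IsOver B γ' ∧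
    γ.coeff B.height ≠ γ'.coeff B.height

/-- Two roots of the trunk attain the least contact order, so they have different coefficients at
`h(B')`. All roots have positive order, which makes that height positive. -/
theorem IsPostbar.isGood (h : IsPostbar f g B c B') : IsGood f g B' := by
  obtain ⟨γ, hγ, γ', hγ', hc⟩ := h.1.1
  obtain ⟨γ₀, hγ₀, hcen⟩ := h.2
  have hpos : 0 < B'.height := by
    have : 0 < contactOrder γ γ' :=
      (lt_min hγ.1.1.1 hγ'.1.1.1).trans_le HahnSeries.min_orderTop_le_orderTop_sub
    rw [← hc] at this
    exact_mod_cast this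
  refine ⟨⟨hpos, ?_, ?_⟩, γ, hγ.1, γ', hγ'.1, h.isOver hγ, h.isOver hγ', ?_⟩
  · refine lt_orderTop_iff.mpr fun e he => ?_
    rw [hcen, HahnSeries.coeff_truncLT_of_lt (he.trans_lt hpos)]
    exact lt_orderTop_iff.mp hγ₀.1.1.1 e he
  · intro e he
    rw [hcen, HahnSeries.coeff_truncLT_of_le he]
  · have := HahnSeries.coeff_orderTop_ne hc.symm
    rwa [HahnSeries.coeff_sub, sub_ne_zero] at this

theorem IsPostbar.unique (h : IsPostbar f g B c B') (h' : IsPostbar f g B c B'') : B' = B'' := by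
  have hh : B'.height = B''.height := by
    have := h.1.unique h'.1
    exact_mod_cast this
  obtain ⟨γ, hγ, -⟩ := h.1.1
  refine Bar.ext ?_ hh
  ext e
  rcases lt_or_ge e B'.height with he | he
  · rw [← h.coeff_center hγ he, ← h'.coeff_center hγ (hh ▸ he)]
  · rw [h.isGood.coeff_center e he, h'.isGood.coeff_center e (hh ▸ he)]

theorem exists_isPostbar (hfin : (roots (f * g)).Finite)
    (h : (trunk (f * g) B c).Nontrivial) : ∃ B', IsPostbar f g B c B' := by
  have hT : (trunk (f * g) B c).Finite := hfin.subset fun γ hγ => hγ.1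
  obtain ⟨γ, hγ, γ', hγ', hne⟩ := h
  obtain ⟨p, hp, hmin⟩ := Set.exists_min_image (trunk (f * g) B c ×ˢ trunk (f * g) B c)
    (fun p => contactOrder p.1 p.2) (hT.prod hT) ⟨(γ, γ'), hγ, hγ'⟩
  have hlt : contactOrder p.1 p.2 < ⊤ := (hmin (γ, γ') ⟨hγ, hγ'⟩).trans_lt
    (HahnSeries.orderTop_lt_top.mpr (sub_ne_zero.mpr hne))
  obtain ⟨b, hb⟩ := WithTop.ne_top_iff_exists.mp hlt.ne
  refine ⟨⟨HahnSeries.truncLT b γ, b⟩, ⟨⟨p.1, hp.1, p.2, hp.2, hb⟩, ?_⟩, γ, hγ, rfl⟩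
  rintro o ⟨δ, hδ, δ', hδ', rfl⟩
  change (b : WithTop ℚ) ≤ _
  rw [hb]
  exact hmin (δ, δ') ⟨hδ, hδ'⟩

theorem IsBar.eq_ground_or_isGood (h : IsBar f g B) : B = groundBar ∨ IsGood f g B := by
  cases h with
  | ground => exact Or.inl rfl
  | post _ h => exact Or.inr h.isGood

/-- A postbar is determined by three roots: two whose contact order is its height, and one whose
truncation is its series. -/
theorem finite_isPostbar (hfin : (roots (f * g)).Finite) :
    {B' : Bar | ∃ B c, IsPostbar f g B c B'}.Finite := by
  refine (((hfin.prod hfin).prod hfin).image fun p =>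
    (⟨HahnSeries.truncLT ((contactOrder p.1.1 p.1.2).untopD 0) p.2,
      (contactOrder p.1.1 p.1.2).untopD 0⟩ : Bar)).subset ?_
  rintro B' ⟨B, c, ⟨⟨γ, hγ, γ', hγ', hc⟩, -⟩, γ₀, hγ₀, hcen⟩
  refine ⟨((γ, γ'), γ₀), ⟨⟨hγ.1, hγ'.1⟩, hγ₀.1⟩, ?_⟩
  simp only [← hc, WithTop.untopD_coe]
  exact Bar.ext hcen.symm rfl

end Postbars

/-! ### The repair as the set of bars reached by collinear steps -/

section Repair

variable {f g : Series2} {Sf Sg : Multiset (HahnSeries ℚ ℂ)} {B B' : Bar}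

/-- The relation between a bar and its postbars supported at collinear points. -/
def CollinearStep (f g : Series2) (B B' : Bar) : Prop :=
  ∃ c ∈ collinearPoints f g B, IsPostbar f g B c B'

open Relation

theorem collinear_or_nonCollinear {c : ℂ} (hc : c ∈ trunkPoints f g B) :
    c ∈ collinearPoints f g B ∨ c ∈ nonCollinearPoints f g B := by
  by_cases h : delta f g B c = 0
  · exact Or.inl ⟨hc, h⟩
  · exact Or.inr ⟨hc, h⟩

theorem not_collinear_of_nonCollinear {c : ℂ} (hc : c ∈ nonCollinearPoints f g B) :
    c ∉ collinearPoints f g B := fun h => hc.2 h.2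

theorem transGen_isGood (h : TransGen (CollinearStep f g) B B') : IsGood f g B' := by
  cases h with
  | single h => exact h.choose_spec.2.isGood
  | tail _ h => exact h.choose_spec.2.isGood

theorem isOver_of_reflTransGen (h : ReflTransGen (CollinearStep f g) B B')
    {ξ : HahnSeries ℚ ℂ} (hξ : IsOver B' ξ) : IsOver B ξ := by
  induction h using ReflTransGen.head_induction_on with
  | refl => exact hξ
  | head h _ ih => exact (h.choose_spec.2.climbsAt ih).1

theorem climbsAt_of_transGen (h : TransGen (CollinearStep f g) B B')
    {ξ : HahnSeries ℚ ℂ} (hξ : IsOver B' ξ) : ∃ c ∈ collinearPoints f g B, ClimbsAt ξ B c := by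
  obtain ⟨B₁, ⟨c, hc, h₁⟩, h₂⟩ := TransGen.head'_iff.mp h
  exact ⟨c, hc, h₁.climbsAt (isOver_of_reflTransGen h₂ hξ)⟩

theorem height_lt_of_transGen (h : TransGen (CollinearStep f g) B B') : B.height < B'.height := by
  induction h with
  | single h => exact h.choose_spec.2.height_lt
  | tail _ h ih => exact ih.trans h.choose_spec.2.height_lt

/-- An arc leaves the collinear part of the tree above a bar in at most one bar. -/
theorem eq_of_climbsAt_nonCollinear {B₀ B₁ B₂ : Bar} {ξ : HahnSeries ℚ ℂ} {a₁ a₂ : ℂ}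
    (h₁ : ReflTransGen (CollinearStep f g) B₀ B₁) (ha₁ : a₁ ∈ nonCollinearPoints f g B₁)
    (hξ₁ : ClimbsAt ξ B₁ a₁) (h₂ : ReflTransGen (CollinearStep f g) B₀ B₂)
    (ha₂ : a₂ ∈ nonCollinearPoints f g B₂) (hξ₂ : ClimbsAt ξ B₂ a₂) : B₁ = B₂ := by
  induction h₁ using ReflTransGen.head_induction_on with
  | refl =>
    -- Were the second bar properly above the first, the arc would climb over the first at a
    -- collinear point.
    rcases reflTransGen_iff_eq_or_transGen.mp h₂ with h | h
    · exact h.symm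
    · obtain ⟨c, hc, hξ⟩ := climbsAt_of_transGen h hξ₂.1
      rw [hξ.unique hξ₁] at hc
      exact absurd hc (not_collinear_of_nonCollinear ha₁)
  | @head X Y hXY hY ih =>
    obtain ⟨c, hc, hpost⟩ := hXY
    have hξc := hpost.climbsAt (isOver_of_reflTransGen hY hξ₁.1)
    rcases ReflTransGen.cases_head h₂ with rfl | ⟨Y', ⟨c', hc', hpost'⟩, hY'⟩
    · rw [hξc.unique hξ₂] at hc
      exact absurd hc (not_collinear_of_nonCollinear ha₂)
    · have hξc' := hpost'.climbsAt (isOver_of_reflTransGen hY' hξ₂.1)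
      rw [hξc'.unique hξc] at hpost'
      rw [hpost'.unique hpost] at hY'
      exact ih hY'

/-- The roots that climb over a bar. -/
def rootsOver (f g : Series2) (B : Bar) : Set (HahnSeries ℚ ℂ) :=
  {γ | γ ∈ roots (f * g) ∧ IsOver B γ}

/-- Two roots that split on `B` cannot both climb at `c`. The number of roots over a bar is thus a
decreasing measure for the inductions up the tree. -/
theorem IsPostbar.rootsOver_ssubset {c : ℂ} (h : IsPostbar f g B c B') (hB : IsGood f g B) :
    rootsOver f g B' ⊂ rootsOver f g B := by
  refine ⟨fun γ hγ => ⟨hγ.1, (h.climbsAt hγ.2).1⟩, fun hsub => ?_⟩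
  obtain ⟨γ, hγ, γ', hγ', h1, h2, hne⟩ := hB.split
  have e1 := (h.climbsAt (hsub ⟨hγ, h1⟩).2).2
  have e2 := (h.climbsAt (hsub ⟨hγ', h2⟩).2).2
  exact hne (e1.trans e2.symm)

namespace IsTreeRoots

theorem exists_isPostbar_of_collinear (h : IsTreeRoots f g Sf Sg) (hB : IsAdmissible B) {c : ℂ}
    (hc : c ∈ collinearPoints f g B) : ∃ B', IsPostbar f g B c B' := by
  classical
  apply exists_isPostbar h.finite_roots
  have h2 := h.two_le_count_of_collinear hB hc
  rw [← ncard_trunk h.mem_mul h.nodup] at h2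
  exact (Set.one_lt_ncard_iff_nontrivial_and_finite.mp h2).1

theorem ncard_rootsOver_lt (h : IsTreeRoots f g Sf Sg) {c : ℂ} (hp : IsPostbar f g B c B')
    (hB : IsGood f g B) : (rootsOver f g B').ncard < (rootsOver f g B).ncard :=
  Set.ncard_lt_ncard (hp.rootsOver_ssubset hB) (h.finite_roots.subset fun _ hγ => hγ.1)

/-- The roots in a collinear trunk leave the collinear part of the tree. -/
theorem exists_transGen_nonCollinear (h : IsTreeRoots f g Sf Sg) (hB : IsGood f g B) {c : ℂ}
    (hc : c ∈ collinearPoints f g B) {γ : HahnSeries ℚ ℂ} (hγ : γ ∈ trunk (f * g) B c) :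
    ∃ B', TransGen (CollinearStep f g) B B' ∧ ∃ a ∈ nonCollinearPoints f g B', ClimbsAt γ B' a := by
  induction hn : (rootsOver f g B).ncard using Nat.strong_induction_on generalizing B c with
  | _ n ih =>
  obtain ⟨B', hp⟩ := h.exists_isPostbar_of_collinear hB.toIsAdmissible hc
  have hover := hp.isOver hγ
  have hstep : CollinearStep f g B B' := ⟨c, hc, hp⟩
  rcases collinear_or_nonCollinear (f := f) (g := g) (B := B') (c := γ.coeff B'.height)
    ⟨γ, hγ.1, hover.climbsAt⟩ with h' | h'
  · obtain ⟨B₁, h₁, ha⟩ := ih _ (hn ▸ h.ncard_rootsOver_lt hp hB) hp.isGood h'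
      ⟨hγ.1, hover.climbsAt⟩ rfl
    exact ⟨B₁, TransGen.head hstep h₁, ha⟩
  · exact ⟨B', TransGen.single hstep, _, h', hover.climbsAt⟩

/-- As long as there is a collinear point, a postbar exists and carries fewer roots. When none is
left, the bar is purely non-collinear because some root climbs over it. -/
theorem exists_reflTransGen_purely (h : IsTreeRoots f g Sf Sg) (hB : IsGood f g B) :
    ∃ B', ReflTransGen (CollinearStep f g) B B' ∧ IsPurelyNonCollinear f g B' := by
  induction hn : (rootsOver f g B).ncard using Nat.strong_induction_on generalizing B with
  | _ n ih =>
  by_cases hC : collinearPoints f g B = ∅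
  · obtain ⟨γ, hγ, -, -, hover, -, -⟩ := hB.split
    refine ⟨B, ReflTransGen.refl, hC, γ.coeff B.height, ?_⟩
    refine (collinear_or_nonCollinear ⟨γ, hγ, hover.climbsAt⟩).resolve_left ?_
    rw [hC]
    exact Set.notMem_empty _
  · obtain ⟨c, hc⟩ := Set.nonempty_iff_ne_empty.mpr hC
    obtain ⟨B', hp⟩ := h.exists_isPostbar_of_collinear hB.toIsAdmissible hc
    obtain ⟨B₁, h₁, hpure⟩ := ih _ (hn ▸ h.ncard_rootsOver_lt hp hB) hp.isGood rfl
    exact ⟨B₁, ReflTransGen.head ⟨c, hc, hp⟩ h₁, hpure⟩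

end IsTreeRoots

theorem reflTransGen_of_mem_chain {α : Type*} {r : α → α → Prop} {l : List α} {a b : α}
    (hl : l.IsChain r) (ha : l.head? = some a) (hb : b ∈ l) : ReflTransGen r a b := by
  induction l generalizing a with
  | nil => simp at hb
  | cons x l ih =>
    obtain rfl : x = a := by simpa using ha
    rcases List.mem_cons.mp hb with rfl | hb
    · exact ReflTransGen.refl
    · cases l with
      | nil => simp at hb
      | cons y l =>
        rw [List.isChain_cons_cons] at hl
        exact ReflTransGen.head hl.1 (ih hl.2 rfl hb)

theorem exists_chain_of_reflTransGen {α : Type*} {r : α → α → Prop} {a b c : α}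
    (hab : ReflTransGen r a b) (hbc : ReflTransGen r b c) :
    ∃ l : List α, (a :: l).IsChain r ∧ (a :: l).getLast? = some c ∧ b ∈ a :: l := by
  induction hab using ReflTransGen.head_induction_on with
  | refl =>
    obtain ⟨l, hl, hlast⟩ := List.exists_isChain_cons_of_relationReflTransGen hbc
    refine ⟨l, hl, ?_, by simp⟩
    rw [List.getLast?_eq_getLast_of_ne_nil (List.cons_ne_nil _ _), hlast]
  | @head x y hxy _ ih =>
    obtain ⟨l, hl, hlast, hmem⟩ := ih
    exact ⟨y :: l, List.isChain_cons_cons.mpr ⟨hxy, hl⟩,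
      by rwa [List.getLast?_cons_cons], List.mem_cons_of_mem _ hmem⟩

namespace IsTreeRoots

/-- The purely non-collinear last bar is no restriction, since every chain of collinear steps
extends to one. Heights increase strictly, so no chain returns to `B`. -/
theorem mem_repair_iff (h : IsTreeRoots f g Sf Sg) :
    B' ∈ repair f g B ↔ TransGen (CollinearStep f g) B B' := by
  constructor
  · rintro ⟨hne, l, ⟨hhead, hchain, -⟩, hmem⟩
    have := reflTransGen_of_mem_chain (r := CollinearStep f g) hchain hhead hmem
    exact (reflTransGen_iff_eq_or_transGen.mp this).resolve_left hne
  · intro ht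
    refine ⟨fun heq => ?_, ?_⟩
    · have := height_lt_of_transGen ht
      rw [heq] at this
      exact lt_irrefl _ this
    · obtain ⟨B₁, h₁, hpure⟩ := h.exists_reflTransGen_purely (transGen_isGood ht)
      obtain ⟨l, hl, hlast, hmem⟩ := exists_chain_of_reflTransGen ht.to_reflTransGen h₁
      exact ⟨B :: l, ⟨rfl, hl, B₁, hlast, hpure⟩, hmem⟩

theorem finite_repair (h : IsTreeRoots f g Sf Sg) (B : Bar) : (repair f g B).Finite := by
  refine (finite_isPostbar h.finite_roots).subset fun B' hB' => ?_
  cases h.mem_repair_iff.mp hB' with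
  | single h => exact ⟨_, _, h.choose_spec.2⟩
  | tail _ h => exact ⟨_, _, h.choose_spec.2⟩

end IsTreeRoots

end Repair

end TreeModel

end

noncomputable section

namespace TreeModel

/-! ### Counting the weeds -/

section Weeds

open Classical in
-- Additivity over mutually exclusive conditions, for multisets because roots of the Jacobian may
-- repeat.
theorem card_filter_exists {α ι : Type*} (I : Finset ι) (P : ι → α → Prop) (S : Multiset α)
    (h : ∀ i ∈ I, ∀ j ∈ I, ∀ x ∈ S, P i x → P j x → i = j) :
    (S.filter fun x => ∃ i ∈ I, P i x).card = ∑ i ∈ I, (S.filter (P i)).card := by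
  induction S using Multiset.induction_on with
  | empty => simp
  | cons x S ih =>
    have ih' := ih fun i hi j hj y hy => h i hi j hj y (Multiset.mem_cons_of_mem hy)
    have hsum : ∑ i ∈ I, ((x ::ₘ S).filter (P i)).card =
        ∑ i ∈ I, (if P i x then 1 else 0) + ∑ i ∈ I, (S.filter (P i)).card := by
      rw [← Finset.sum_add_distrib]
      refine Finset.sum_congr rfl fun i _ => ?_
      by_cases hi : P i x
      · rw [Multiset.filter_cons_of_pos _ hi, Multiset.card_cons, if_pos hi, add_comm]
      · rw [Multiset.filter_cons_of_neg _ hi, if_neg hi, zero_add]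
    rw [hsum, ← ih']
    by_cases hx : ∃ i ∈ I, P i x
    · rw [Multiset.filter_cons_of_pos (p := fun x => ∃ i ∈ I, P i x) _ hx, Multiset.card_cons, add_comm]
      obtain ⟨i, hi, hPi⟩ := hx
      rw [Finset.sum_eq_single_of_mem i hi, if_pos hPi]
      intro j hj hne
      exact if_neg fun hPj => hne (h j hj i hi x (Multiset.mem_cons_self x S) hPj hPi)
    · rw [Multiset.filter_cons_of_neg (p := fun x => ∃ i ∈ I, P i x) _ hx, Finset.sum_eq_zero, zero_add]
      intro i hi
      exact if_neg fun hPi => hx ⟨i, hi, hPi⟩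

variable {f g : Series2} {Sf Sg : Multiset (HahnSeries ℚ ℂ)} {B : Bar}

namespace IsTreeRoots

theorem finite_collinearPoints (h : IsTreeRoots f g Sf Sg) (B : Bar) :
    (collinearPoints f g B).Finite :=
  (h.finite_trunkPoints B).subset fun _ hc => hc.1

theorem finite_nonCollinearPoints (h : IsTreeRoots f g Sf Sg) (B : Bar) :
    (nonCollinearPoints f g B).Finite :=
  (h.finite_trunkPoints B).subset fun _ hc => hc.1

theorem trunkPoints_ground {c : ℂ} (hc : c ∈ trunkPoints f g groundBar) : c = 0 := by
  obtain ⟨γ, hγ, hcl⟩ := hc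
  rw [← hcl.2]
  exact lt_orderTop_iff.mp hγ.1.1 0 le_rfl

open Polynomial in
-- All roots have positive order, so the only trunk grows at `0` and the rational function is `Δ /
-- z` with `Δ ≠ 0`.
theorem collinear_union_meroZeros_ground (h : IsTreeRoots f g Sf Sg)
    (hN : IsNonCollinear f g groundBar) :
    collinearPoints f g groundBar = ∅ ∧ meroZeros f g groundBar = ∅ := by
  classical
  obtain ⟨c, hc⟩ := hN
  have hc0 := trunkPoints_ground hc.1
  subst hc0
  constructor
  · rw [Set.eq_empty_iff_forall_notMem]
    intro c hc'
    have := trunkPoints_ground hc'.1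
    subst this
    exact not_collinear_of_nonCollinear hc hc'
  · have hT : (overCoeffs groundBar (Sf + Sg)).toFinset = {0} := by
      ext c
      rw [← Finset.mem_coe, ← h.trunkPoints_eq, Finset.mem_singleton]
      exact ⟨trunkPoints_ground, fun h0 => h0 ▸ hc.1⟩
    rw [Set.eq_empty_iff_forall_notMem]
    intro z hz
    have hz' : (meroFunction f g groundBar).num.IsRoot z := hz
    rw [h.meroFunction_eq, hT] at hz'
    set d : ℂ → ℂ := fun c => ((delta f g groundBar c : ℚ) : ℂ) with hd
    have key := polarSum_num_denom {0} d
    rw [Finset.sum_singleton, Finset.erase_singleton, Finset.prod_empty, mul_one] at key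
    have hdvd : (polarSum {0} d).num ∣ C (d 0) :=
      (RatFunc.isCoprime_num_denom _).dvd_of_dvd_mul_right (Dvd.intro _ key)
    have h0 : (C (d 0)).eval z = 0 := hz'.dvd hdvd
    rw [eval_C] at h0
    exact hc.2 (Rat.cast_eq_zero.mp h0)

theorem weeds_formula_ground (h : IsTreeRoots f g Sf Sg) (hN : IsNonCollinear f g groundBar) :
    (weeds f g groundBar).Finite ∧
      numWeeds f g groundBar = numMeroZeros f g groundBar +
        ∑ᶠ B' ∈ repair f g groundBar, numNonCollinear f g B' := by
  obtain ⟨hC, hM⟩ := h.collinear_union_meroZeros_ground hN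
  have hW : weeds f g groundBar = ∅ := by
    rw [Set.eq_empty_iff_forall_notMem]
    rintro γ ⟨-, ⟨a, ha, -⟩, -⟩
    rw [hC, hM, Set.union_empty] at ha
    exact ha
  have hR : repair f g groundBar = ∅ := by
    rw [Set.eq_empty_iff_forall_notMem]
    intro B' hB'
    obtain ⟨B₁, ⟨c, hc, -⟩, -⟩ := Relation.TransGen.head'_iff.mp (h.mem_repair_iff.mp hB')
    rw [hC] at hc
    exact hc
  rw [numWeeds, numMeroZeros, hW, hM, hR]
  simp

/-- Above a non-collinear point of a bar in the repair, the roots of the Jacobian are not weeds. -/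
theorem mem_collinear_union_meroZeros_iff (h : IsTreeRoots f g Sf Sg) (hB : IsAdmissible B)
    {e : ℕ} {U : Series2} {S : Multiset (HahnSeries ℚ ℂ)}
    (hS : IsPuiseuxFactorization (jacobian f g) e U S) {ξ : HahnSeries ℚ ℂ} (hξ : ξ ∈ S)
    {a : ℂ} (ha : ClimbsAt ξ B a) :
    a ∈ collinearPoints f g B ∪ meroZeros f g B ↔ a ∉ nonCollinearPoints f g B := by
  classical
  constructor
  · rintro (hC | hM) hN
    · exact not_collinear_of_nonCollinear hN hC
    · exact (h.mem_meroZeros_iff ⟨a, hN⟩).mp hM (h.meroMult_eq_zero hN)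
  · intro hN
    -- On a non-collinear bar, a root of the Jacobian climbing away from all trunks is accounted for
    -- by a mero-zero. On any other bar every point is a mero-zero by convention.
    by_cases hBN : IsNonCollinear f g B
    · have hcount := (h.count_jacobian hB hBN).2 e U S hS a
      have hpos : 0 < (overCoeffs B S).count a :=
        Multiset.count_pos.mpr (mem_overCoeffs.mpr ⟨ξ, hξ, ha⟩)
      rw [if_neg hN, add_zero] at hcount
      by_cases hT : a ∈ trunkPoints f g B
      · exact Or.inl ((collinear_or_nonCollinear hT).resolve_right hN)
      · rw [h.trunkPoints_eq, Finset.mem_coe, Multiset.mem_toFinset] at hT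
        rw [Multiset.count_eq_zero_of_notMem hT, zero_add] at hcount
        exact Or.inr ((h.mem_meroZeros_iff hBN).mpr (by omega))
    · exact Or.inr (by rw [meroZeros_eq_univ hBN]; exact Set.mem_univ _)

/-- The defining condition on the repair becomes the absence of an exit at a non-collinear point,
which can be counted. -/
theorem mem_weeds_iff (h : IsTreeRoots f g Sf Sg) {e : ℕ} {U : Series2}
    {S : Multiset (HahnSeries ℚ ℂ)} (hS : IsPuiseuxFactorization (jacobian f g) e U S)
    {ξ : HahnSeries ℚ ℂ} :
    ξ ∈ weeds f g B ↔ ξ ∈ S ∧ (∃ a ∈ collinearPoints f g B ∪ meroZeros f g B, ClimbsAt ξ B a) ∧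
      ¬ ∃ B' ∈ repair f g B, ∃ a ∈ nonCollinearPoints f g B', ClimbsAt ξ B' a := by
  have hpolar : ξ ∈ polarRoots f g ↔ ξ ∈ S := by
    rw [polarRoots_eq h.simple h.constantCoeff_left h.constantCoeff_right, hS.mem_roots_iff]
  rw [← hpolar]
  refine and_congr_right fun hξ => and_congr_right fun _ => ?_
  rw [hpolar] at hξ
  have hiff : ∀ B' ∈ repair f g B, ∀ a, ClimbsAt ξ B' a →
      (a ∈ collinearPoints f g B' ∪ meroZeros f g B' ↔ a ∉ nonCollinearPoints f g B') :=
    fun B' hB' a ha => h.mem_collinear_union_meroZeros_iff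
      (transGen_isGood (h.mem_repair_iff.mp hB')).toIsAdmissible hS hξ ha
  constructor
  · rintro hw ⟨B', hB', a, ha, hcl⟩
    exact (hiff B' hB' a hcl).mp (hw B' hB' a hcl) ha
  · intro hw B' hB' a hcl
    exact (hiff B' hB' a hcl).mpr fun ha => hw ⟨B', hB', a, ha, hcl⟩

open Classical in
theorem numWeeds_eq_card (h : IsTreeRoots f g Sf Sg) {e : ℕ} {U : Series2}
    {S : Multiset (HahnSeries ℚ ℂ)} (hS : IsPuiseuxFactorization (jacobian f g) e U S) :
    (weeds f g B).Finite ∧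
      numWeeds f g B = (S.filter fun ξ => ξ ∈ weeds f g B).card := by
  have hsub : ∀ ξ ∈ weeds f g B, ξ ∈ S := fun ξ hξ => ((h.mem_weeds_iff hS).mp hξ).1
  have hset : weeds f g B = ((S.filter fun ξ => ξ ∈ weeds f g B).toFinset : Set _) := by
    ext ξ
    simp only [Multiset.toFinset_filter, Finset.coe_filter, Multiset.mem_toFinset,
      Set.mem_ofPred_eq]
    exact ⟨fun hξ => ⟨hsub ξ hξ, hξ⟩, fun hξ => hξ.2⟩
  refine ⟨hset ▸ Finset.finite_toSet _, ?_⟩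
  rw [numWeeds, hset, finsum_mem_coe_finset, ← hset, ← Multiset.toFinset_sum_count_eq]
  refine Finset.sum_congr rfl fun ξ hξ => ?_
  rw [Multiset.mem_toFinset, Multiset.mem_filter] at hξ
  rw [hS.rootMult_eq_count hξ.1, Multiset.count_filter_of_pos hξ.2]

open Classical in
/-- The number of roots of the Jacobian that climb over a bar at a collinear point or at a
mero-zero. -/
theorem card_filter_collinear_union_meroZeros (h : IsTreeRoots f g Sf Sg) (hB : IsAdmissible B)
    (hN : IsNonCollinear f g B) {e : ℕ} {U : Series2} {S : Multiset (HahnSeries ℚ ℂ)}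
    (hS : IsPuiseuxFactorization (jacobian f g) e U S) :
    (S.filter fun ξ => ∃ a ∈ collinearPoints f g B ∪ meroZeros f g B, ClimbsAt ξ B a).card =
      ((Sf + Sg).filter fun γ => ∃ a ∈ collinearPoints f g B, ClimbsAt γ B a).card +
        numMeroZeros f g B := by
  have hC := h.finite_collinearPoints B
  have hM := h.finite_meroZeros hN
  have hE : ∀ a, a ∈ collinearPoints f g B ∪ meroZeros f g B ↔
      a ∈ hC.toFinset ∪ hM.toFinset := by simp
  have hC' : ∀ a, a ∈ collinearPoints f g B ↔ a ∈ hC.toFinset := by simp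
  have h1 : (S.filter fun ξ =>
      ∃ a ∈ collinearPoints f g B ∪ meroZeros f g B, ClimbsAt ξ B a).card =
      ∑ a ∈ hC.toFinset ∪ hM.toFinset, (overCoeffs B S).count a := by
    simp only [hE, count_overCoeffs]
    exact card_filter_exists _ (fun a ξ => ClimbsAt ξ B a) S
      fun a _ b _ ξ _ ha hb => ha.unique hb
  have h2 : ((Sf + Sg).filter fun γ => ∃ a ∈ collinearPoints f g B, ClimbsAt γ B a).card =
      ∑ a ∈ hC.toFinset, (overCoeffs B (Sf + Sg)).count a := by
    simp only [hC', count_overCoeffs]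
    exact card_filter_exists _ (fun a ξ => ClimbsAt ξ B a) (Sf + Sg)
      fun a _ b _ ξ _ ha hb => ha.unique hb
  have hnot : ∀ a ∈ hC.toFinset ∪ hM.toFinset, a ∉ nonCollinearPoints f g B := by
    intro a ha haN
    rcases (hE a).mpr ha with h' | h'
    · exact not_collinear_of_nonCollinear haN h'
    · exact (h.mem_meroZeros_iff hN).mp h' (h.meroMult_eq_zero haN)
  have h3 : ∑ a ∈ hC.toFinset ∪ hM.toFinset, (overCoeffs B S).count a =
      ∑ a ∈ hC.toFinset ∪ hM.toFinset, (overCoeffs B (Sf + Sg)).count a +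
        ∑ a ∈ hC.toFinset ∪ hM.toFinset, meroMult f g B a := by
    rw [← Finset.sum_add_distrib]
    refine Finset.sum_congr rfl fun a ha => ?_
    have := (h.count_jacobian hB hN).2 e U S hS a
    rwa [if_neg (hnot a ha), add_zero] at this
  -- A mero-zero is not a non-collinear point, so unless it is collinear no root of `f * g` climbs
  -- there.
  have h4 : ∑ a ∈ hC.toFinset, (overCoeffs B (Sf + Sg)).count a =
      ∑ a ∈ hC.toFinset ∪ hM.toFinset, (overCoeffs B (Sf + Sg)).count a := by
    refine Finset.sum_subset Finset.subset_union_left fun a ha ha' => ?_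
    refine Multiset.count_eq_zero_of_notMem fun hmem => ha' ?_
    rw [← hC']
    refine (collinear_or_nonCollinear ?_).resolve_right (hnot a ha)
    rw [h.trunkPoints_eq]
    simpa using hmem
  have h5 : numMeroZeros f g B = ∑ a ∈ hC.toFinset ∪ hM.toFinset, meroMult f g B a := by
    rw [numMeroZeros, finsum_mem_eq_finite_toFinset_sum _ hM]
    refine Finset.sum_subset Finset.subset_union_right fun a _ ha => ?_
    by_contra h'
    exact ha (by simpa using (h.mem_meroZeros_iff hN).mpr h')
  rw [h1, h2, h3, h4, h5]

theorem weeds_formula_of_isGood (h : IsTreeRoots f g Sf Sg) (hB : IsGood f g B)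
    (hN : IsNonCollinear f g B) :
    (weeds f g B).Finite ∧
      numWeeds f g B = numMeroZeros f g B +
        ∑ᶠ B' ∈ repair f g B, numNonCollinear f g B' := by
  classical
  obtain ⟨e, U, S, hS⟩ := exists_isPuiseuxFactorization (h.count_jacobian hB.toIsAdmissible hN).1
  obtain ⟨hfin, hnum⟩ := h.numWeeds_eq_card (B := B) hS
  refine ⟨hfin, ?_⟩
  have hR := h.finite_repair B
  have hNfin := h.finite_nonCollinearPoints
  -- The possible exits: bars of the repair with a non-collinear point on them. Their number is the
  -- sum in the formula, and an arc uses at most one.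
  set I : Finset (Σ _ : Bar, ℂ) :=
    hR.toFinset.sigma fun B' => (hNfin B').toFinset with hI
  have hmemI : ∀ i : Σ _ : Bar, ℂ, i ∈ I ↔
      i.1 ∈ repair f g B ∧ i.2 ∈ nonCollinearPoints f g i.1 := by
    intro i; simp [hI]
  set P : (Σ _ : Bar, ℂ) → HahnSeries ℚ ℂ → Prop := fun i ξ => ClimbsAt ξ i.1 i.2 with hP
  have hdisj : ∀ T : Multiset (HahnSeries ℚ ℂ), ∀ i ∈ I, ∀ j ∈ I, ∀ ξ ∈ T,
      P i ξ → P j ξ → i = j := by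
    rintro T ⟨B₁, a₁⟩ hi ⟨B₂, a₂⟩ hj ξ - h1 h2
    rw [hmemI] at hi hj
    have hBB : B₁ = B₂ := eq_of_climbsAt_nonCollinear
      (h.mem_repair_iff.mp hi.1).to_reflTransGen hi.2 h1
      (h.mem_repair_iff.mp hj.1).to_reflTransGen hj.2 h2
    subst hBB
    have haa : a₁ = a₂ := ClimbsAt.unique h1 h2
    rw [haa]
  set bad : HahnSeries ℚ ℂ → Prop := fun ξ => ∃ i ∈ I, P i ξ with hbad
  have hbad_iff : ∀ ξ, bad ξ ↔
      ∃ B' ∈ repair f g B, ∃ a ∈ nonCollinearPoints f g B', ClimbsAt ξ B' a := by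
    intro ξ
    constructor
    · rintro ⟨i, hi, hc⟩
      exact ⟨i.1, ((hmemI i).mp hi).1, i.2, ((hmemI i).mp hi).2, hc⟩
    · rintro ⟨B', hB', a, ha, hc⟩
      exact ⟨⟨B', a⟩, (hmemI _).mpr ⟨hB', ha⟩, hc⟩
  set above : HahnSeries ℚ ℂ → Prop := fun ξ =>
    ∃ a ∈ collinearPoints f g B ∪ meroZeros f g B, ClimbsAt ξ B a with habove
  have hbad_climbs : ∀ ξ, bad ξ → ∃ a ∈ collinearPoints f g B, ClimbsAt ξ B a := by
    intro ξ hξ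
    obtain ⟨B', hB', a, -, hc⟩ := (hbad_iff ξ).mp hξ
    exact climbsAt_of_transGen (h.mem_repair_iff.mp hB') hc.1
  have hsplit : (S.filter fun ξ => ξ ∈ weeds f g B).card + (S.filter bad).card =
      (S.filter above).card := by
    have e1 : (S.filter fun ξ => ξ ∈ weeds f g B) = (S.filter above).filter fun ξ => ¬ bad ξ := by
      rw [Multiset.filter_filter]
      refine Multiset.filter_congr fun ξ hξ => ?_
      rw [h.mem_weeds_iff hS, hbad_iff, and_iff_right hξ, and_comm]
    have e2 : S.filter bad = (S.filter above).filter bad := by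
      rw [Multiset.filter_filter]
      refine Multiset.filter_congr fun ξ _ => ⟨fun hξ => ⟨hξ, ?_⟩, fun hξ => hξ.1⟩
      obtain ⟨a, ha, hc⟩ := hbad_climbs ξ hξ
      exact ⟨a, Or.inl ha, hc⟩
    rw [e1, e2, ← Multiset.card_add, add_comm, Multiset.filter_add_not]
  have hbadS : (S.filter bad).card = ∑ i ∈ I, (overCoeffs i.1 S).count i.2 := by
    simp only [count_overCoeffs]
    exact card_filter_exists I P S (hdisj S)
  have hbadR : ((Sf + Sg).filter bad).card = ∑ i ∈ I, (overCoeffs i.1 (Sf + Sg)).count i.2 := by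
    simp only [count_overCoeffs]
    exact card_filter_exists I P (Sf + Sg) (hdisj _)
  -- Each exit is a simple pole of the rational function of its bar, which costs exactly one root of
  -- the Jacobian.
  have hone : ∀ i ∈ I, (overCoeffs i.1 S).count i.2 + 1 =
      (overCoeffs i.1 (Sf + Sg)).count i.2 := by
    intro i hi
    obtain ⟨hi1, hi2⟩ := (hmemI i).mp hi
    have := (h.count_jacobian (transGen_isGood (h.mem_repair_iff.mp hi1)).toIsAdmissible
      ⟨_, hi2⟩).2 e U S hS i.2
    rwa [if_pos hi2, h.meroMult_eq_zero hi2, add_zero] at this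
  have hcardI : I.card = ∑ᶠ B' ∈ repair f g B, numNonCollinear f g B' := by
    rw [hI, Finset.card_sigma]
    conv_rhs => rw [← hR.coe_toFinset]
    rw [finsum_mem_coe_finset]
    refine Finset.sum_congr rfl fun B' _ => ?_
    rw [numNonCollinear, Set.ncard_eq_toFinset_card _ (hNfin B')]
  -- Every root of `f * g` in a collinear trunk of `B` does leave through an exit, so the same
  -- number enters both counts and cancels.
  have hroots : (Sf + Sg).filter bad =
      (Sf + Sg).filter fun γ => ∃ a ∈ collinearPoints f g B, ClimbsAt γ B a := by
    refine Multiset.filter_congr fun γ hγ => ⟨hbad_climbs γ, ?_⟩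
    rintro ⟨c, hc, hcl⟩
    obtain ⟨B', hB', ha⟩ := h.exists_transGen_nonCollinear hB hc
      ⟨(h.mem_mul γ).mpr hγ, hcl⟩
    exact (hbad_iff γ).mpr ⟨B', h.mem_repair_iff.mpr hB', ha⟩
  have habv := h.card_filter_collinear_union_meroZeros hB.toIsAdmissible hN hS
  have hsum : (S.filter bad).card + I.card = ((Sf + Sg).filter bad).card := by
    rw [hbadS, hbadR, Finset.card_eq_sum_ones, ← Finset.sum_add_distrib]
    exact Finset.sum_congr rfl hone
  rw [← hroots] at habv
  change (S.filter above).card = _ at habv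
  rw [hnum, ← hcardI]
  omega

end IsTreeRoots

end Weeds

end TreeModel

end

theorem mainTheorem6 (f g : TreeModel.Series2)
    (hf : TreeModel.IsConvergent f) (hg : TreeModel.IsConvergent g)
    (hf0 : MvPowerSeries.constantCoeff f = 0) (hg0 : MvPowerSeries.constantCoeff g = 0)
    (hsimple : TreeModel.HasSimpleRoots (f * g))
    (B : TreeModel.Bar) (hB : TreeModel.IsBar f g B) (hBN : TreeModel.IsNonCollinear f g B) :
    (TreeModel.repair f g B).Finite ∧ (TreeModel.weeds f g B).Finite ∧
      TreeModel.numWeeds f g B =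
        TreeModel.numMeroZeros f g B +
          ∑ᶠ B' ∈ TreeModel.repair f g B, TreeModel.numNonCollinear f g B' := by
  obtain ⟨Sf, Sg, h⟩ := TreeModel.exists_isTreeRoots hf0 hg0 hsimple
  refine ⟨h.finite_repair B, ?_⟩
  rcases hB.eq_ground_or_isGood with rfl | hgood
  · exact h.weeds_formula_ground hBN
  · exact h.weeds_formula_of_isGood hgood hBN
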